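/- **Proposition 1.3.** Let $(X,\mathcal B,m)$ be a standard Borel space with a non-atomic probability measure, and let $\mathrm{MPT}$ be the group of invertible $m$-preserving transformations of $X$ with the coarse topology, which is generated by the sets $$\{T:\ \|f_j\circ T^{s}-f_j\circ T_0^{s}\|_{L^2(m)}<\varepsilon\ \ (1\le j\le N,\ s=\pm1)\},\qquad T_0\in\mathrm{MPT},\ f_1,\dots,f_N\in L^2(m),\ \varepsilon>0 .$$ Let $b=(b_n)$ be a strictly increasing sequence of natural numbers. Call $T\in\mathrm{MPT}$ *IP-rigid along $b$* if $T^{\sum_{j\in F}b_j}\to\mathrm{Id}$ in $\mathrm{MPT}$ as $F$ ranges over the finite nonempty sets of indices with $\min F\to\infty$. Call $T$ *weakly mixing* if $\frac1N\sum_{n=0}^{N-1}|m(A\cap T^{-n}B)-m(A)m(B)|\to0$ for all $A,B\in\mathcal B$. Let $\mathtt{IPRWM}$ be the set of strictly increasing sequences $b$ of natural numbers for which some weakly mixing $T\in\mathrm{MPT}$ is IP-rigid along $b$. Suppose that there is an infinite set $S\subset\mathbb N$ such that $$\sum_{n\in S}\frac{b_n}{b_{n+1}}<\infty\qquad\text{and}\qquad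 b_n\mid b_{n+1}\ \text{ for every } n\notin S .$$ Then $b\in\mathtt{IPRWM}$. -/

import Mathlib

open MeasureTheory Filter Topology

namespace IPRigidity

section MPT

variable {X : Type*} [MeasurableSpace X]

/-- The group, under composition, of bijections `T` of `X` such that `T` and `T⁻¹` are measurable
and preserve the measure `m`. -/
def MPT (m : Measure X) : Subgroup (Equiv.Perm X) where
  carrier := {T | MeasurePreserving (⇑T) m m ∧ MeasurePreserving (⇑T⁻¹) m m}
  one_mem' := ⟨MeasurePreserving.id m, MeasurePreserving.id m⟩
  mul_mem' {S T} hS hT := ⟨hS.1.comp hT.1, by rw [mul_inv_rev]; exact hT.2.comp hS.2⟩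
  inv_mem' {T} hT := ⟨hT.2, by rw [inv_inv]; exact hT.1⟩

/-- The Koopman operator `f ↦ f ∘ T` on `L²(m)`. -/
noncomputable def koopman {m : Measure X} (T : MPT m) (f : Lp ℂ 2 m) : Lp ℂ 2 m :=
  Lp.compMeasurePreserving (⇑(T : Equiv.Perm X)) T.2.1 f

/-- The set `U(T₀, f₁, …, f_N; ε)` of all `T` with `‖f_j ∘ T^s - f_j ∘ T₀^s‖ < ε` in `L²(m)`
for every `j` and for `s = 1` and `s = -1`. -/
def coarseNhd {m : Measure X} (T₀ : MPT m) (fs : Finset (Lp ℂ 2 m)) (ε : ℝ) : Set (MPT m) :=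
  {T | ∀ f ∈ fs, ‖koopman T f - koopman T₀ f‖ < ε ∧ ‖koopman T⁻¹ f - koopman T₀⁻¹ f‖ < ε}

/-- The coarse topology on `MPT m`, generated by the sets `coarseNhd T₀ fs ε` with `ε > 0`.
(Transformations that agree almost everywhere are topologically indistinguishable.) -/
instance coarseTopology (m : Measure X) : TopologicalSpace (MPT m) :=
  TopologicalSpace.generateFrom
    {U | ∃ (T₀ : MPT m) (fs : Finset (Lp ℂ 2 m)) (ε : ℝ), 0 < ε ∧ U = coarseNhd T₀ fs ε}

/-- `T` is weakly mixing: `(1/N) ∑_{n < N} |m(A ∩ T⁻ⁿ B) - m(A) m(B)| → 0` for all measurable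
sets `A` and `B`. -/
def WeaklyMixing {m : Measure X} (T : MPT m) : Prop :=
  ∀ A B : Set X, MeasurableSet A → MeasurableSet B →
    Tendsto (fun N : ℕ => (N : ℝ)⁻¹ * ∑ n ∈ Finset.range N,
      |m.real (A ∩ ⇑((T ^ n : MPT m) : Equiv.Perm X) ⁻¹' B) - m.real A * m.real B|) atTop (𝓝 0)

end MPT

/-- `a(n) → L` along the finite sums of `q`: the points `a(∑_{j ∈ F} q_j)` tend to `L` as
`F` runs over the nonempty finite sets of indices with `min F → ∞`. -/
def IPTendsto {Z : Type*} [TopologicalSpace Z] (q : ℕ → ℕ) (a : ℕ → Z) (L : Z) : Prop :=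
  ∀ U ∈ 𝓝 L, ∃ K : ℕ, ∀ F : Finset ℕ, F.Nonempty → (∀ j ∈ F, K ≤ j) → a (∑ j ∈ F, q j) ∈ U

/-- `T` is IP-rigid along `b`: `T ^ n → Id` in the coarse topology along the finite sums
of `b`. -/
def IPRigid {X : Type*} [MeasurableSpace X] {m : Measure X} (T : MPT m) (b : ℕ → ℕ) : Prop :=
  IPTendsto b (fun n => T ^ n) 1

/-- The strictly increasing sequences along which some weakly mixing, invertible,
measure-preserving transformation of `(X, m)` is IP-rigid. -/
def IPRWM {X : Type*} [MeasurableSpace X] (m : Measure X) : Set (ℕ → ℕ) :=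
  {b | StrictMono b ∧ ∃ T : MPT m, WeaklyMixing T ∧ IPRigid T b}

end IPRigidity

/-!
The transformation is the shift of a stationary Gaussian process whose spectral measure is
non-atomic and concentrated on angles `θ` at which all the `e^{i b_n θ}` are close to `1`.

*The spectral measure.* After deleting finitely many terms, `b` at least doubles at each step, and
grows fivefold at the steps in `S`. An angle `2πx` is built by successive corrections of `x`: at a
step `n ∈ S` the point is moved to one of the next two multiples of `1 / b_{n+1}`, and at the other
steps it is kept. Since `b_n ∣ b_{n+1}` at these other steps, `b_n x` is an integer at stage `n`, and
the later corrections change `b_n x` by at most `2 ∑_{j ≥ n, j ∈ S} b_n / b_{j+1}`. These bounds are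
summable over `n`, because `b` grows geometrically and `∑_{n ∈ S} b_n / b_{n+1} < ∞`
(`FastGrowth.summable_mul_gapTail`). The binary choices at the steps in `S` give uncountably many
points (`FastGrowth.injOn_cantorPoint`), so the closed set of all angles satisfying the bounds carries
a non-atomic probability measure (`exists_rigid_measure`).

*The process.* A real Hilbert space embeds isometrically in an `L²` space as a space of Gaussian
variables (`exists_isonormal`). Applied to `L²(μ; ℂ)` over the reals and the functions `e^{inθ}`, this
gives a law on `ℤ → ℝ` with an explicit characteristic function (`exists_isGaussianLaw`), which is
invariant under the shift.

*Weak mixing and rigidity.* Both properties may be tested on the exponentials `exp (i ∑ c_n x_n)`,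
which span a dense subspace of `L²` (`span_expLp`). Their correlations are controlled by Fourier
coefficients of functions times `μ`, which tend to zero in mean by Wiener's lemma
(`cesaroNull_fourier`, `weaklyMixing_shiftMPT`). The displacement of an exponential by the `N`-th
power of the shift is at most a constant times the supremum of `|e^{iNθ} - 1|`, and for
`N = ∑_{j ∈ F} b_j` this is at most a tail of a convergent series (`ipRigid_shiftMPT`).

*Arbitrary spaces.* The Gaussian law has no atoms, so it is isomorphic to any standard non-atomic
probability space (`exists_measurePreserving_equiv`), and the properties are transported by
conjugation.
-/

namespace IPRigidity

/-! ### A non-atomic measure on the circle concentrated near the `b n`-th roots of unity -/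

/-- An uncountable Borel subset of a standard Borel space carries a non-atomic probability
measure: it is Borel isomorphic to the unit interval. -/
lemma exists_nonatomic_of_uncountable {α : Type*} [MeasurableSpace α] [StandardBorelSpace α]
    {K : Set α} (hK : MeasurableSet K) (hunc : ¬ K.Countable) :
    ∃ μ : Measure α, IsProbabilityMeasure μ ∧ NullSingletonClass μ ∧ ∀ᵐ x ∂μ, x ∈ K := by
  have : StandardBorelSpace K := hK.standardBorel
  have hI : ¬ Countable unitInterval := by
    intro hc
    have h0 : (volume : Measure unitInterval) Set.univ = 0 :=
      Set.countable_univ.measure_zero volume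
    simp at h0
  let e : unitInterval ≃ᵐ K := PolishSpace.measurableEquivOfNotCountable hI hunc
  have hme : MeasurableEmbedding (fun t => (e t : α)) :=
    (MeasurableEmbedding.subtype_coe hK).comp e.measurableEmbedding
  refine ⟨(volume : Measure unitInterval).map (fun t => (e t : α)),
    Measure.isProbabilityMeasure_map hme.measurable.aemeasurable, ⟨fun x => ?_⟩, ?_⟩
  · rw [hme.map_apply]
    exact (Set.subsingleton_singleton.preimage hme.injective).measure_zero _
  · rw [hme.ae_map_iff]
    exact Eventually.of_forall fun t => (e t).2

section Cantor

variable {b : ℕ → ℕ} {S : Set ℕ}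

/-- The sequence equal to `1 / b (j + 1)` for `j ∈ S` and to `0` otherwise. -/
noncomputable def gapInv (b : ℕ → ℕ) (S : Set ℕ) : ℕ → ℝ :=
  S.indicator fun j => ((b (j + 1) : ℝ))⁻¹

/-- The tail sums `∑_{j ≥ n, j ∈ S} 1 / b (j + 1)`. -/
noncomputable def gapTail (b : ℕ → ℕ) (S : Set ℕ) (n : ℕ) : ℝ := ∑' j, gapInv b S (j + n)

lemma gapInv_nonneg (j : ℕ) : 0 ≤ gapInv b S j :=
  Set.indicator_nonneg (fun _ _ => by positivity) j

lemma gapTail_nonneg (n : ℕ) : 0 ≤ gapTail b S n := tsum_nonneg fun _ => gapInv_nonneg _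

/-- A growth condition satisfied, after deleting finitely many terms, by the sequences under
consideration: `b` at least doubles at each step, and grows fivefold at the steps in `S`. -/
structure FastGrowth (b : ℕ → ℕ) (S : Set ℕ) : Prop where
  pos : ∀ n, 0 < b n
  two_mul_le : ∀ n, 2 * b n ≤ b (n + 1)
  five_mul_le : ∀ n ∈ S, 5 * b n ≤ b (n + 1)

namespace FastGrowth

/-- At a step in `S` the new term contributes at most `1/5` and the remaining sum at most
`1/4 * 1/5`; at any other step there is no new term and the sum is halved. -/
lemma mul_sum_gapInv_le (h : FastGrowth b S) (M n : ℕ) :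
    (b n : ℝ) * ∑ j ∈ Finset.range M, gapInv b S (j + n) ≤ 1 / 4 := by
  induction M generalizing n with
  | zero => simp
  | succ M ih =>
    rw [Finset.sum_range_succ']
    have h1 := ih (n + 1)
    have e : ∀ j, j + 1 + n = j + (n + 1) := fun j => by ring
    simp only [e, zero_add]
    set s := ∑ j ∈ Finset.range M, gapInv b S (j + (n + 1))
    have hs : 0 ≤ s := Finset.sum_nonneg fun _ _ => gapInv_nonneg _
    have hp : (0 : ℝ) < b (n + 1) := by exact_mod_cast h.pos _
    by_cases hn : n ∈ S
    · have h5 : (5 : ℝ) * b n ≤ b (n + 1) := by exact_mod_cast h.five_mul_le n hn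
      have : (b n : ℝ) * (b (n + 1) : ℝ)⁻¹ ≤ 1 / 5 := by
        rw [← div_eq_mul_inv, div_le_iff₀ hp]; linarith
      have h6 := mul_le_mul_of_nonneg_right h5 hs
      simp only [gapInv, Set.indicator_of_mem hn]
      linarith
    · have h2 : (2 : ℝ) * b n ≤ b (n + 1) := by exact_mod_cast h.two_mul_le n
      have h6 := mul_le_mul_of_nonneg_right h2 hs
      simp only [gapInv, Set.indicator_of_notMem hn]
      linarith

lemma summable_gapInv (h : FastGrowth b S) : Summable (gapInv b S) := by
  refine summable_of_sum_range_le (c := 1 / 4) gapInv_nonneg fun M => ?_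
  have h1 := h.mul_sum_gapInv_le M 0
  have h0 : (1 : ℝ) ≤ b 0 := by exact_mod_cast h.pos 0
  have hs : 0 ≤ ∑ j ∈ Finset.range M, gapInv b S j := Finset.sum_nonneg fun _ _ => gapInv_nonneg _
  simp only [add_zero] at h1
  nlinarith

lemma gapTail_eq (h : FastGrowth b S) (n : ℕ) :
    gapTail b S n = gapInv b S n + gapTail b S (n + 1) := by
  have := ((summable_nat_add_iff n).2 h.summable_gapInv).tsum_eq_zero_add
  simp only [gapTail]
  rw [this, zero_add]
  congr 2
  ext j
  congr 1
  ring

lemma mul_gapTail_le (h : FastGrowth b S) (n : ℕ) : (b n : ℝ) * gapTail b S n ≤ 1 / 4 := by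
  have hs := ((summable_nat_add_iff n).2 h.summable_gapInv).hasSum.tendsto_sum_nat
  exact le_of_tendsto' (hs.const_mul (b n : ℝ)) fun M => h.mul_sum_gapInv_le M n

/-- The recursion `v n ≤ (b n / b (n + 1)) 1_S(n) + v (n + 1) / 2` for `v n = b n * gapTail n`
bounds the partial sums of `v` by twice the sum over `S`. -/
lemma summable_mul_gapTail (h : FastGrowth b S)
    (hsum : Summable fun n : S => (b n : ℝ) / (b (n + 1) : ℝ)) :
    Summable fun n => (b n : ℝ) * gapTail b S n := by
  set a : ℕ → ℝ := S.indicator fun n => (b n : ℝ) / (b (n + 1) : ℝ) with ha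
  have has : Summable a := (summable_subtype_iff_indicator (s := S)
    (f := fun n => (b n : ℝ) / (b (n + 1) : ℝ))).1 hsum
  have ha0 : ∀ n, 0 ≤ a n := fun n => Set.indicator_nonneg (fun _ _ => by positivity) n
  set v : ℕ → ℝ := fun n => (b n : ℝ) * gapTail b S n with hv
  have hv0 : ∀ n, 0 ≤ v n := fun n => mul_nonneg (by positivity) (gapTail_nonneg n)
  have hrec : ∀ n, v n ≤ a n + v (n + 1) / 2 := by
    intro n
    have h2 : (2 : ℝ) * b n ≤ b (n + 1) := by exact_mod_cast h.two_mul_le n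
    have h6 := mul_le_mul_of_nonneg_right h2 (gapTail_nonneg (b := b) (S := S) (n + 1))
    have : (b n : ℝ) * gapInv b S n = a n := by
      by_cases hn : n ∈ S <;> simp [gapInv, ha, hn, div_eq_mul_inv]
    simp only [hv]
    rw [h.gapTail_eq n, mul_add, this]
    linarith
  refine summable_of_sum_range_le (c := 2 * ∑' n, a n + 1) hv0 fun N => ?_
  have h1 : ∑ n ∈ Finset.range N, v n
      ≤ ∑ n ∈ Finset.range N, a n + (∑ n ∈ Finset.range N, v (n + 1)) / 2 := by
    rw [Finset.sum_div, ← Finset.sum_add_distrib]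
    exact Finset.sum_le_sum fun n _ => hrec n
  have h2 : ∑ n ∈ Finset.range N, v (n + 1) + v 0 = ∑ n ∈ Finset.range N, v n + v N := by
    rw [← Finset.sum_range_succ', Finset.sum_range_succ]
  have h3 : ∑ n ∈ Finset.range N, a n ≤ ∑' n, a n := has.sum_le_tsum _ fun n _ => ha0 n
  have h4 : v N ≤ 1 / 4 := h.mul_gapTail_le N
  linarith [hv0 0]

end FastGrowth

open Classical in
/-- The approximations of the point of the Cantor set coded by a set `A` of digits. At a step
`n ∈ S` the point moves to the next multiple of `1 / b (n + 1)` above it, or to the one after it,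
depending on whether `n ∈ A`. At the other steps `b n ∣ b (n + 1)`, and the point stays. -/
noncomputable def cantorApprox (b : ℕ → ℕ) (S A : Set ℕ) : ℕ → ℝ
  | 0 => 0
  | n + 1 => if n ∈ S then
      (⌈(b (n + 1) : ℝ) * cantorApprox b S A n⌉ + if n ∈ A then 1 else 0) / (b (n + 1) : ℝ)
    else cantorApprox b S A n

lemma cantorApprox_of_mem {A : Set ℕ} {n : ℕ} (hn : n ∈ S) (hA : n ∈ A) :
    cantorApprox b S A (n + 1) =
      (⌈(b (n + 1) : ℝ) * cantorApprox b S A n⌉ + 1) / (b (n + 1) : ℝ) := by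
  simp [cantorApprox, hn, hA]

lemma cantorApprox_of_notMem {A : Set ℕ} {n : ℕ} (hn : n ∈ S) (hA : n ∉ A) :
    cantorApprox b S A (n + 1) =
      ⌈(b (n + 1) : ℝ) * cantorApprox b S A n⌉ / (b (n + 1) : ℝ) := by
  simp [cantorApprox, hn, hA]

lemma cantorApprox_of_notMem_left {A : Set ℕ} {n : ℕ} (hn : n ∉ S) :
    cantorApprox b S A (n + 1) = cantorApprox b S A n := by
  simp [cantorApprox, hn]

/-- The point of the Cantor set coded by `A`. -/
noncomputable def cantorPoint (b : ℕ → ℕ) (S A : Set ℕ) : ℝ :=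
  ∑' n, (cantorApprox b S A (n + 1) - cantorApprox b S A n)

namespace FastGrowth

variable (h : FastGrowth b S)
include h

lemma cantorApprox_isInt (hdvd : ∀ n : ℕ, n ∉ S → b n ∣ b (n + 1)) (A : Set ℕ) (n : ℕ) :
    ∃ k : ℤ, (b n : ℝ) * cantorApprox b S A n = k := by
  induction n with
  | zero => exact ⟨0, by simp [cantorApprox]⟩
  | succ n ih =>
    have hp : (b (n + 1) : ℝ) ≠ 0 := by exact_mod_cast (h.pos _).ne'
    by_cases hn : n ∈ S
    · by_cases hA : n ∈ A
      · exact ⟨⌈(b (n + 1) : ℝ) * cantorApprox b S A n⌉ + 1, by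
          rw [cantorApprox_of_mem hn hA]; field_simp; push_cast; ring⟩
      · exact ⟨⌈(b (n + 1) : ℝ) * cantorApprox b S A n⌉, by
          rw [cantorApprox_of_notMem hn hA]; field_simp⟩
    · obtain ⟨k, hk⟩ := ih
      obtain ⟨q, hq⟩ := hdvd n hn
      refine ⟨q * k, ?_⟩
      rw [cantorApprox_of_notMem_left hn, hq]
      push_cast
      rw [← hk]
      ring

lemma cantorApprox_sub_mem (A : Set ℕ) (n : ℕ) :
    cantorApprox b S A (n + 1) - cantorApprox b S A n ∈ Set.Icc 0 (2 * gapInv b S n) := by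
  have hp : (0 : ℝ) < b (n + 1) := by exact_mod_cast h.pos _
  by_cases hn : n ∈ S
  · have h1 := Int.le_ceil ((b (n + 1) : ℝ) * cantorApprox b S A n)
    have h2 := (Int.ceil_lt_add_one ((b (n + 1) : ℝ) * cantorApprox b S A n)).le
    have hg : 2 * gapInv b S n = 2 / (b (n + 1) : ℝ) := by
      simp [gapInv, hn, div_eq_mul_inv]
    rw [hg, Set.mem_Icc, sub_nonneg, sub_le_iff_le_add]
    have e : 2 / (b (n + 1) : ℝ) + cantorApprox b S A n
        = (2 + b (n + 1) * cantorApprox b S A n) / b (n + 1) := by field_simp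
    rw [e]
    by_cases hA : n ∈ A
    · rw [cantorApprox_of_mem hn hA, le_div_iff₀ hp, div_le_div_iff_of_pos_right hp]
      constructor <;> linarith
    · rw [cantorApprox_of_notMem hn hA, le_div_iff₀ hp, div_le_div_iff_of_pos_right hp]
      constructor <;> linarith
  · rw [cantorApprox_of_notMem_left hn]
    simp [gapInv, hn]

lemma cantorPoint_sub_mem (A : Set ℕ) (n : ℕ) :
    cantorPoint b S A - cantorApprox b S A n ∈ Set.Icc 0 (2 * gapTail b S n) := by
  set d : ℕ → ℝ := fun n => cantorApprox b S A (n + 1) - cantorApprox b S A n with hd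
  have hds : Summable d := Summable.of_nonneg_of_le (fun n => (h.cantorApprox_sub_mem A n).1)
    (fun n => (h.cantorApprox_sub_mem A n).2) (h.summable_gapInv.mul_left 2)
  have h1 : ∑ j ∈ Finset.range n, d j = cantorApprox b S A n := by
    rw [Finset.sum_range_sub]; simp [cantorApprox]
  have h2 : cantorPoint b S A - cantorApprox b S A n = ∑' j, d (j + n) := by
    rw [cantorPoint, ← hds.sum_add_tsum_nat_add n, h1, add_sub_cancel_left]
  rw [h2]
  refine ⟨tsum_nonneg fun j => (h.cantorApprox_sub_mem A _).1, ?_⟩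
  rw [gapTail, ← tsum_mul_left]
  exact Summable.tsum_le_tsum (fun j => (h.cantorApprox_sub_mem A _).2)
    ((summable_nat_add_iff n).2 hds) (((summable_nat_add_iff n).2 h.summable_gapInv).mul_left 2)

/-- Two codes that agree before `n` give points on different sides of a gap, since
`2 * gapTail (n + 1)` is at most half the grid size `1 / b (n + 1)`. -/
lemma cantorPoint_lt {A A' : Set ℕ} {n : ℕ} (hn : n ∈ S) (hA : n ∈ A) (hA' : n ∉ A')
    (hlt : ∀ k < n, k ∈ A ↔ k ∈ A') : cantorPoint b S A' < cantorPoint b S A := by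
  have heq : ∀ k ≤ n, cantorApprox b S A k = cantorApprox b S A' k := by
    intro k
    induction k with
    | zero => intro _; rfl
    | succ k ih =>
      intro hk
      simp only [cantorApprox, ih (by omega)]
      by_cases hk' : k ∈ A
      · rw [if_pos hk', if_pos ((hlt k (by omega)).1 hk')]
      · rw [if_neg hk', if_neg (mt (hlt k (by omega)).2 hk')]
  have hp : (0 : ℝ) < b (n + 1) := by exact_mod_cast h.pos _
  have h1 := (h.cantorPoint_sub_mem A (n + 1)).1
  have h2 := (h.cantorPoint_sub_mem A' (n + 1)).2
  have h3 := h.mul_gapTail_le (n + 1)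
  rw [cantorApprox_of_mem hn hA, heq n le_rfl, add_div] at h1
  rw [cantorApprox_of_notMem hn hA'] at h2
  have h4 : 2 * gapTail b S (n + 1) < 1 / b (n + 1) := by
    rw [lt_div_iff₀ hp]
    nlinarith
  linarith

lemma injOn_cantorPoint : Set.InjOn (cantorPoint b S) (𝒫 S) := by
  intro A hA A' hA' heq
  classical
  by_contra hne
  have hex : ∃ n, ¬ (n ∈ A ↔ n ∈ A') := by
    by_contra! hall
    exact hne (Set.ext hall)
  have hmin : ∀ k < Nat.find hex, k ∈ A ↔ k ∈ A' := fun k hk => not_not.1 (Nat.find_min hex hk)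
  have hsp := Nat.find_spec hex
  by_cases hn : Nat.find hex ∈ A
  · have hn' : Nat.find hex ∉ A' := fun h' => hsp ⟨fun _ => h', fun _ => hn⟩
    exact (h.cantorPoint_lt (hA hn) hn hn' hmin).ne' heq
  · have hn' : Nat.find hex ∈ A' := by
      by_contra h'
      exact hsp ⟨fun h1 => absurd h1 hn, fun h1 => absurd h1 h'⟩
    exact (h.cantorPoint_lt (hA' hn') hn' hn fun k hk => (hmin k hk).symm).ne heq

lemma cantorPoint_mem (A : Set ℕ) : cantorPoint b S A ∈ Set.Icc 0 (1 / 2 : ℝ) := by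
  have h1 := h.cantorPoint_sub_mem A 0
  have h2 := h.mul_gapTail_le 0
  have h0 : (1 : ℝ) ≤ b 0 := by exact_mod_cast h.pos 0
  have h3 := gapTail_nonneg (b := b) (S := S) 0
  simp only [cantorApprox, sub_zero] at h1
  exact ⟨h1.1, h1.2.trans (by nlinarith)⟩

/-- Replacing the point by its distance to the grid point `cantorApprox n`, which `b n` multiplies
to an integer, does not change the exponential. -/
lemma norm_exp_cantorPoint_le (hdvd : ∀ n : ℕ, n ∉ S → b n ∣ b (n + 1)) (A : Set ℕ) (n : ℕ) :
    ‖Complex.exp (((b n : ℝ) * (2 * Real.pi * cantorPoint b S A) : ℝ) * Complex.I) - 1‖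
      ≤ 4 * Real.pi * (b n * gapTail b S n) := by
  obtain ⟨k, hk⟩ := h.cantorApprox_isInt hdvd A n
  set y := cantorPoint b S A
  set x := cantorApprox b S A n
  have e : Complex.exp (((b n : ℝ) * (2 * Real.pi * y) : ℝ) * Complex.I)
      = Complex.exp (Complex.I * ((b n * (2 * Real.pi * (y - x)) : ℝ) : ℂ)) := by
    rw [Complex.exp_eq_exp_iff_exists_int]
    refine ⟨k, ?_⟩
    have : ((b n : ℝ) * (2 * Real.pi * y) : ℝ) = b n * (2 * Real.pi * (y - x)) + 2 * Real.pi * k := by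
      rw [← hk]; ring
    rw [this]
    push_cast
    ring
  rw [e]
  refine Real.norm_exp_I_mul_ofReal_sub_one_le.trans ?_
  have h1 := h.cantorPoint_sub_mem A n
  have hpi := Real.pi_pos
  have : 0 ≤ (b n : ℝ) * (2 * Real.pi * (y - x)) := by
    have := h1.1
    positivity
  rw [Real.norm_of_nonneg this]
  have h3 : (b n : ℝ) * (2 * Real.pi) * (y - x) ≤ (b n : ℝ) * (2 * Real.pi) * (2 * gapTail b S n) :=
    mul_le_mul_of_nonneg_left h1.2 (by positivity)
  linarith

/-- The points coded by the subsets of `S` form an uncountable subset of the closed set of angles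
`t` for which `exp (i b_n t)` is within `4π b_n gapTail n` of `1` for all `n`. -/
theorem exists_measure_of_fastGrowth (hS : S.Infinite) (hdvd : ∀ n : ℕ, n ∉ S → b n ∣ b (n + 1)) :
    ∃ μ : Measure ℝ, IsProbabilityMeasure μ ∧ NullSingletonClass μ ∧
      (∀ᵐ t ∂μ, t ∈ Set.Ico 0 (2 * Real.pi)) ∧
      ∀ᵐ t ∂μ, ∀ n, ‖Complex.exp (((b n : ℝ) * t : ℝ) * Complex.I) - 1‖
        ≤ 4 * Real.pi * (b n * gapTail b S n) := by
  set K : Set ℝ := Set.Ico 0 (2 * Real.pi) ∩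
    {t | ∀ n, ‖Complex.exp (((b n : ℝ) * t : ℝ) * Complex.I) - 1‖
      ≤ 4 * Real.pi * (b n * gapTail b S n)} with hKdef
  have hK : MeasurableSet K := by
    refine measurableSet_Ico.inter (IsClosed.measurableSet ?_)
    simp only [Set.ofPred_forall]
    exact isClosed_iInter fun n => isClosed_le (by fun_prop) continuous_const
  have hpi := Real.pi_pos
  have hunc : ¬ K.Countable := by
    intro hc
    have hmaps : Set.MapsTo (fun A => 2 * Real.pi * cantorPoint b S A) (𝒫 S) K := by
      intro A _
      have := h.cantorPoint_mem A
      refine ⟨⟨mul_nonneg (by positivity) this.1, ?_⟩,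
        fun n => h.norm_exp_cantorPoint_le hdvd A n⟩
      nlinarith [this.2]
    have hinj : Set.InjOn (fun A => 2 * Real.pi * cantorPoint b S A) (𝒫 S) := by
      intro A hA A' hA' heq
      exact h.injOn_cantorPoint hA hA' (mul_left_cancel₀ (by positivity) heq)
    have hc' : (𝒫 S).Countable := Set.MapsTo.countable_of_injOn hmaps hinj hc
    have := hc'.to_subtype
    let f := hS.natEmbedding
    -- `𝒫 S` contains a copy of the power set of `ℕ`, so it is uncountable by Cantor's theorem.
    have hg : Function.Injective (fun A : Set ℕ =>
        (⟨(fun n => (f n : ℕ)) '' A, by rintro _ ⟨n, _, rfl⟩; exact (f n).2⟩ : 𝒫 S)) := by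
      intro A A' heq
      have hfi : Function.Injective fun n => (f n : ℕ) := Subtype.val_injective.comp f.injective
      exact hfi.image_injective (congrArg Subtype.val heq)
    obtain ⟨g, hg'⟩ := exists_injective_nat (𝒫 S)
    exact Function.cantor_injective _ (hg'.comp hg)
  obtain ⟨μ, h1, h2, h3⟩ := exists_nonatomic_of_uncountable hK hunc
  exact ⟨μ, h1, h2, h3.mono fun t ht => ht.1, h3.mono fun t ht => ht.2⟩

end FastGrowth

/-- Along the sequence `b`, all but finitely many terms grow fast. -/
lemma exists_fastGrowth (hb : StrictMono b)
    (hsum : Summable fun n : S => (b n : ℝ) / (b (n + 1) : ℝ))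
    (hdvd : ∀ n : ℕ, n ∉ S → b n ∣ b (n + 1)) :
    ∃ N, FastGrowth (fun n => b (n + N)) {n | n + N ∈ S} := by
  have has : Summable (S.indicator fun n => (b n : ℝ) / (b (n + 1) : ℝ)) :=
    (summable_subtype_iff_indicator (s := S)
      (f := fun n => (b n : ℝ) / (b (n + 1) : ℝ))).1 hsum
  obtain ⟨N, hN⟩ := eventually_atTop.1
    ((has.tendsto_atTop_zero.eventually (gt_mem_nhds (show (0 : ℝ) < 1 / 5 by norm_num))).and
      (eventually_ge_atTop 1))
  have hpos : ∀ n, N ≤ n → 0 < b n := fun n hn =>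
    (Nat.zero_le _).trans_lt (hb (show 0 < n by have := (hN N le_rfl).2; omega))
  have h5 : ∀ n, N ≤ n → n ∈ S → 5 * b n ≤ b (n + 1) := by
    intro n hn hnS
    have h1 := (hN n hn).1
    have hp : (0 : ℝ) < b (n + 1) := by exact_mod_cast hpos (n + 1) (by omega)
    rw [Set.indicator_of_mem hnS, div_lt_iff₀ hp] at h1
    have : (5 : ℝ) * b n ≤ b (n + 1) := by linarith
    exact_mod_cast this
  refine ⟨N, fun n => hpos _ (by omega), fun n => ?_, fun n hn => ?_⟩
  · rw [show n + 1 + N = n + N + 1 by ring]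
    by_cases hn : n + N ∈ S
    · have := h5 _ (by omega) hn
      omega
    · obtain ⟨q, hq⟩ := hdvd _ hn
      have hlt := hb (Nat.lt_succ_self (n + N))
      have h0 := hpos (n + N) (by omega)
      simp only [Nat.succ_eq_add_one] at hlt
      rw [hq] at hlt ⊢
      have : 2 ≤ q := by
        by_contra! hq2
        have : b (n + N) * q ≤ b (n + N) * 1 := Nat.mul_le_mul_left _ (by omega)
        omega
      rw [mul_comm]
      exact Nat.mul_le_mul_left _ this
  · have := h5 (n + N) (by omega) hn
    rwa [show n + 1 + N = n + N + 1 by ring]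

/-- The spectral measure: a non-atomic probability measure for which the functions `e^{i b_n t}` are
uniformly close to `1`, with summable errors. The finitely many terms of `b` outside the range of
fast growth are given the trivial error `2`. -/
theorem exists_rigid_measure (hb : StrictMono b) (hS : S.Infinite)
    (hsum : Summable fun n : S => (b n : ℝ) / (b (n + 1) : ℝ))
    (hdvd : ∀ n : ℕ, n ∉ S → b n ∣ b (n + 1)) :
    ∃ μ : Measure ℝ, IsProbabilityMeasure μ ∧ NullSingletonClass μ ∧
      (∀ᵐ t ∂μ, t ∈ Set.Ico 0 (2 * Real.pi)) ∧ ∃ δ : ℕ → ℝ, Summable δ ∧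
      ∀ᵐ t ∂μ, ∀ n, ‖Complex.exp (((b n : ℝ) * t : ℝ) * Complex.I) - 1‖ ≤ δ n := by
  obtain ⟨N, h⟩ := exists_fastGrowth hb hsum hdvd
  set b' : ℕ → ℕ := fun n => b (n + N) with hb'
  set S' : Set ℕ := {n | n + N ∈ S} with hS'
  have hS'inf : S'.Infinite := by
    intro hfin
    refine hS (((hfin.image (· + N)).union (Set.finite_lt_nat N)).subset fun n hn => ?_)
    rcases lt_or_ge n N with hlt | hge
    · exact Or.inr hlt
    · refine Or.inl ⟨n - N, ?_, Nat.sub_add_cancel hge⟩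
      simpa [hS', Nat.sub_add_cancel hge] using hn
  have hsum' : Summable fun n : S' => (b' n : ℝ) / (b' (n + 1) : ℝ) := by
    have hinj : Function.Injective (fun n : S' => (⟨(n : ℕ) + N, n.2⟩ : S)) := by
      intro m n hmn
      have := congrArg Subtype.val hmn
      exact Subtype.ext (by simpa using this)
    refine (hsum.comp_injective hinj).congr fun n => ?_
    simp only [Function.comp, hb']
    rw [show (n : ℕ) + 1 + N = n + N + 1 by ring]
  have hdvd' : ∀ n : ℕ, n ∉ S' → b' n ∣ b' (n + 1) := by
    intro n hn
    simp only [hb']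
    rw [show n + 1 + N = n + N + 1 by ring]
    exact hdvd _ hn
  obtain ⟨μ, h1, h2, h3, h4⟩ := h.exists_measure_of_fastGrowth hS'inf hdvd'
  refine ⟨μ, h1, h2, h3, fun n => if n < N then 2 else
    4 * Real.pi * (b' (n - N) * gapTail b' S' (n - N)), ?_, ?_⟩
  · rw [← summable_nat_add_iff N]
    simpa using (h.summable_mul_gapTail hsum').mul_left (4 * Real.pi)
  · filter_upwards [h4] with t ht n
    by_cases hn : n < N
    · rw [if_pos hn]
      refine (norm_sub_le _ _).trans ?_
      rw [Complex.norm_exp_ofReal_mul_I, norm_one]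
      norm_num
    · rw [if_neg hn]
      have := ht (n - N)
      simp only [hb', Nat.sub_add_cancel (not_lt.1 hn)] at this
      simpa only [hb', Nat.sub_add_cancel (not_lt.1 hn)] using this

end Cantor

/-! ### Stationary Gaussian processes with a prescribed spectral measure -/

section Gaussian
open ProbabilityTheory Complex

lemma norm_exp_mul_I_sub_le (a c : ℝ) : ‖exp (a * I) - exp (c * I)‖ ≤ |a - c| := by
  have : exp ((a : ℂ) * I) - exp (c * I) = exp (c * I) * (exp (I * ((a - c : ℝ) : ℂ)) - 1) := by
    rw [mul_sub, ← Complex.exp_add, mul_one]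
    congr 2
    push_cast
    ring
  rw [this, norm_mul, Complex.norm_exp_ofReal_mul_I, one_mul]
  exact Real.norm_exp_I_mul_ofReal_sub_one_le

lemma integrable_exp_mul_I {Ω : Type*} [MeasurableSpace Ω] {P : Measure Ω} [IsProbabilityMeasure P]
    {f : Ω → ℝ} (hf : AEStronglyMeasurable f P) : Integrable (fun ω => exp (f ω * I)) P := by
  refine Integrable.of_bound (C := 1) ?_ (Eventually.of_forall fun ω => ?_)
  · have : Continuous fun x : ℝ => exp (x * I) := by fun_prop
    exact this.comp_aestronglyMeasurable hf
  · rw [Complex.norm_exp_ofReal_mul_I]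

/-- The characteristic function `f ↦ ∫ exp (i f)` is a continuous function on `L²`. -/
lemma continuous_integral_exp {Ω : Type*} [MeasurableSpace Ω] (P : Measure Ω)
    [IsProbabilityMeasure P] : Continuous fun f : Lp ℝ 2 P => ∫ ω, exp ((f ω : ℝ) * I) ∂P := by
  refine (LipschitzWith.of_dist_le_mul (K := 1) fun f g => ?_).continuous
  rw [dist_eq_norm, dist_eq_norm, NNReal.coe_one, one_mul,
    ← integral_sub (integrable_exp_mul_I (Lp.aestronglyMeasurable f))
      (integrable_exp_mul_I (Lp.aestronglyMeasurable g))]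
  have hint : Integrable (⇑(f - g)) P := (Lp.memLp (f - g)).integrable (by norm_num)
  calc ‖∫ ω, (exp ((f ω : ℝ) * I) - exp ((g ω : ℝ) * I)) ∂P‖
      ≤ ∫ ω, ‖(f - g) ω‖ ∂P := by
        refine norm_integral_le_of_norm_le hint.norm ?_
        filter_upwards [Lp.coeFn_sub f g] with ω hω
        rw [hω]
        exact norm_exp_mul_I_sub_le _ _
    _ = (eLpNorm (⇑(f - g)) 1 P).toReal := by
        rw [integral_norm_eq_lintegral_enorm hint.1, eLpNorm_one_eq_lintegral_enorm]
    _ ≤ ‖f - g‖ := by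
        rw [Lp.norm_def]
        exact ENNReal.toReal_mono (Lp.memLp (f - g)).2.ne
          (eLpNorm_le_eLpNorm_of_exponent_le (by norm_num) (Lp.aestronglyMeasurable _))

lemma coeFn_sum_smul {Ω E κ : Type*} [MeasurableSpace Ω] {P : Measure Ω} [NormedAddCommGroup E]
    [NormedSpace ℝ E] (s : Finset κ) (a : κ → ℝ) (u : κ → Lp E 2 P) :
    ⇑(∑ i ∈ s, a i • u i) =ᵐ[P] fun x => ∑ i ∈ s, a i • u i x := by
  classical
  induction s using Finset.induction_on with
  | empty =>
    simp only [Finset.sum_empty]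
    exact Lp.coeFn_zero E 2 P
  | insert i s hi ih =>
    rw [Finset.sum_insert hi]
    filter_upwards [Lp.coeFn_add (a i • u i) (∑ i ∈ s, a i • u i), Lp.coeFn_smul (a i) (u i), ih]
      with x h1 h2 h3
    rw [h1, Pi.add_apply, h2, h3, Finset.sum_insert hi, Pi.smul_apply]

section IIDGaussian

variable (ι : Type*)

/-- The law of a family, indexed by `ι`, of independent standard Gaussian variables. -/
noncomputable abbrev stdGaussians : Measure (ι → ℝ) :=
  Measure.infinitePi fun _ : ι => gaussianReal 0 1

lemma memLp_eval_stdGaussians (i : ι) :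
    MemLp (fun x : ι → ℝ => x i) 2 (stdGaussians ι) :=
  (memLp_id_gaussianReal (μ := 0) (v := 1) 2).comp_measurePreserving
    (measurePreserving_eval_infinitePi (fun _ : ι => gaussianReal 0 1) i)

/-- The `i`-th coordinate as an element of `L²`. -/
noncomputable def gaussianCoord (i : ι) : Lp ℝ 2 (stdGaussians ι) :=
  (memLp_eval_stdGaussians ι i).toLp

lemma iIndepFun_eval_stdGaussians :
    iIndepFun (fun (i : ι) (x : ι → ℝ) => x i) (stdGaussians ι) :=
  iIndepFun_infinitePi (X := fun _ x => x) fun _ => measurable_id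

lemma orthonormal_gaussianCoord : Orthonormal ℝ (gaussianCoord ι) := by
  classical
  rw [orthonormal_iff_ite]
  intro i j
  have h1 : inner ℝ (gaussianCoord ι i) (gaussianCoord ι j)
      = ∫ x : ι → ℝ, x i * x j ∂(stdGaussians ι) := by
    rw [L2.inner_def]
    refine integral_congr_ae ?_
    filter_upwards [(memLp_eval_stdGaussians ι i).coeFn_toLp,
      (memLp_eval_stdGaussians ι j).coeFn_toLp] with x hi hj
    simp only [gaussianCoord, hi, hj]
    simp [mul_comm]
  have hmp := fun i => measurePreserving_eval_infinitePi (fun _ : ι => gaussianReal 0 1) i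
  rw [h1]
  split_ifs with hij
  · subst hij
    have h2 : ∫ x : ι → ℝ, x i * x i ∂(stdGaussians ι) = ∫ y, y * y ∂(gaussianReal 0 1) := by
      rw [← (hmp i).map_eq, integral_map (hmp i).measurable.aemeasurable (by fun_prop)]
    have h3 := variance_id_gaussianReal (μ := 0) (v := 1)
    rw [variance_eq_integral measurable_id.aemeasurable] at h3
    rw [h2]
    simpa [pow_two] using h3
  · have h2 := ((iIndepFun_eval_stdGaussians ι).indepFun hij).integral_mul_eq_mul_integral
      (measurable_pi_apply i).aestronglyMeasurable (measurable_pi_apply j).aestronglyMeasurable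
    have h3 : ∫ x : ι → ℝ, x i ∂(stdGaussians ι) = 0 := by
      have : ∫ x : ι → ℝ, x i ∂(stdGaussians ι) = ∫ y, y ∂(gaussianReal 0 1) := by
        rw [← (hmp i).map_eq, integral_map (hmp i).measurable.aemeasurable (by fun_prop)]
      rw [this]
      simp
    simp only [Pi.mul_apply] at h2
    rw [h2, h3, zero_mul]

lemma integral_exp_sum_stdGaussians (s : Finset ι) (a : ι → ℝ) :
    ∫ x : ι → ℝ, exp ((∑ i ∈ s, a i * x i : ℝ) * I) ∂(stdGaussians ι)
      = exp (-(∑ i ∈ s, a i ^ 2 : ℝ) / 2) := by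
  have hind : iIndepFun (fun (i : s) (x : ι → ℝ) => exp ((a i * x i : ℝ) * I))
      (stdGaussians ι) := by
    have := ((iIndepFun_eval_stdGaussians ι).precomp (g := fun i : s => (i : ι))
      Subtype.val_injective).comp (fun i y => exp ((a i * y : ℝ) * I)) (fun i => by fun_prop)
    exact this
  have h1 : ∀ x : ι → ℝ, exp ((∑ i ∈ s, a i * x i : ℝ) * I)
      = ∏ i : s, exp ((a i * x i : ℝ) * I) := by
    intro x
    rw [← Complex.exp_sum, ← Finset.sum_coe_sort s, ← Finset.sum_mul]
    push_cast
    rfl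
  have h2 : ∀ i : ι, ∫ x : ι → ℝ, exp ((a i * x i : ℝ) * I) ∂(stdGaussians ι)
      = exp (-(a i ^ 2 : ℝ) / 2) := by
    intro i
    have hmp := measurePreserving_eval_infinitePi (fun _ : ι => gaussianReal 0 1) i
    have h3 : ∫ x : ι → ℝ, exp ((a i * x i : ℝ) * I) ∂(stdGaussians ι)
        = ∫ y : ℝ, exp ((a i * y : ℝ) * I) ∂(gaussianReal 0 1) := by
      rw [← hmp.map_eq, integral_map hmp.measurable.aemeasurable (by fun_prop)]
    have h4 := charFun_gaussianReal (μ := 0) (v := 1) (a i)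
    rw [charFun_apply_real] at h4
    rw [h3]
    push_cast
    rw [h4]
    simp [neg_div]
  rw [integral_congr_ae (Eventually.of_forall h1),
    hind.integral_fun_prod_eq_prod_integral fun i => Measurable.aestronglyMeasurable (by fun_prop)]
  simp only [h2]
  rw [← Complex.exp_sum, Finset.sum_coe_sort s fun i => (-(a i ^ 2 : ℝ) / 2 : ℂ)]
  congr 1
  push_cast
  rw [← Finset.sum_div, Finset.sum_neg_distrib]

end IIDGaussian

universe u in
/-- Every real Hilbert space embeds isometrically into the `L²` space of some probability space in
such a way that the image of `h` is a centred Gaussian variable of variance `‖h‖²`. The embedding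
takes a Hilbert basis to independent standard Gaussian variables. -/
theorem exists_isonormal {H : Type u} [NormedAddCommGroup H] [InnerProductSpace ℝ H]
    [CompleteSpace H] : ∃ (ι : Type u) (W : H →ₗᵢ[ℝ] Lp ℝ 2 (stdGaussians ι)),
      ∀ h, ∫ x, exp ((W h x : ℝ) * I) ∂(stdGaussians ι) = exp (-(‖h‖ ^ 2 : ℝ) / 2) := by
  obtain ⟨ι, B, -⟩ := exists_hilbertBasis ℝ H
  have hV := orthonormal_gaussianCoord ι
  let W : H →ₗᵢ[ℝ] Lp ℝ 2 (stdGaussians ι) :=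
    hV.orthogonalFamily.linearIsometry.comp B.repr.toLinearIsometry
  have hWB : ∀ i, W (B i) = gaussianCoord ι i := by
    classical
    intro i
    change hV.orthogonalFamily.linearIsometry (B.repr (B i)) = _
    rw [B.repr_self, OrthogonalFamily.linearIsometry_apply_single]
    simp
  refine ⟨ι, W, fun h => ?_⟩
  have hfin : ∀ (s : Finset ι) (a : ι → ℝ),
      ∫ x, exp ((W (∑ i ∈ s, a i • B i) x : ℝ) * I) ∂(stdGaussians ι)
        = exp (-(‖∑ i ∈ s, a i • B i‖ ^ 2 : ℝ) / 2) := by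
    intro s a
    have hnorm : ‖∑ i ∈ s, a i • B i‖ ^ 2 = ∑ i ∈ s, a i ^ 2 := by
      rw [← real_inner_self_eq_norm_sq, B.orthonormal.inner_sum]
      simp [pow_two]
    rw [hnorm, ← integral_exp_sum_stdGaussians]
    refine integral_congr_ae ?_
    have h1 : W (∑ i ∈ s, a i • B i) = ∑ i ∈ s, a i • gaussianCoord ι i := by
      simp [map_sum, hWB]
    have h2 : ⇑(∑ i ∈ s, a i • gaussianCoord ι i) =ᵐ[stdGaussians ι]
        fun x => ∑ i ∈ s, a i * x i := by
      filter_upwards [coeFn_sum_smul s a (gaussianCoord ι),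
        (ae_ball_iff s.countable_toSet).2 fun i _ => (memLp_eval_stdGaussians ι i).coeFn_toLp]
        with x h3 h4
      rw [h3]
      exact Finset.sum_congr rfl fun i hi => by rw [gaussianCoord, h4 i hi, smul_eq_mul]
    rw [h1]
    filter_upwards [h2] with x hx
    rw [hx]
  have hlim := B.hasSum_repr h
  have hc1 : Continuous fun h : H => ∫ x, exp ((W h x : ℝ) * I) ∂(stdGaussians ι) :=
    (continuous_integral_exp _).comp W.continuous
  have hc2 : Continuous fun h : H => exp (-(‖h‖ ^ 2 : ℝ) / 2) := by fun_prop
  refine tendsto_nhds_unique ((hc1.tendsto h).comp hlim) ?_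
  refine ((hc2.tendsto h).comp hlim).congr fun s => ?_
  exact (hfin s _).symm

/-- The trigonometric polynomial `∑ c n e^{inθ}`. -/
noncomputable def trigSum (c : ℤ →₀ ℝ) (θ : ℝ) : ℂ :=
  c.sum fun n a => (a : ℂ) * exp ((n * θ : ℝ) * I)

/-- The linear functional `x ↦ ∑ c n x n`. -/
noncomputable def pairing (c : ℤ →₀ ℝ) (x : ℤ → ℝ) : ℝ := c.sum fun n a => a * x n

/-- The variance `∫ |∑ c n e^{inθ}|² dμ` of `∑ c n X n` when `X` has spectral measure `μ`. -/
noncomputable def energy (μ : Measure ℝ) (c : ℤ →₀ ℝ) : ℝ := ∫ θ, ‖trigSum c θ‖ ^ 2 ∂μ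

/-- `ν` is the law of the centred stationary Gaussian process with spectral measure `μ`. The
spectral measure is seen on the line of angles, and need not be symmetric: only the real parts of
its Fourier coefficients enter. -/
def IsGaussianLaw (μ : Measure ℝ) (ν : Measure (ℤ → ℝ)) : Prop :=
  ∀ c : ℤ →₀ ℝ, ∫ x, exp (pairing c x * I) ∂ν = exp (-(energy μ c : ℝ) / 2)

lemma continuous_trigSum (c : ℤ →₀ ℝ) : Continuous (trigSum c) := by
  unfold trigSum Finsupp.sum
  fun_prop

lemma continuous_pairing (c : ℤ →₀ ℝ) : Continuous (pairing c) := by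
  unfold pairing Finsupp.sum
  fun_prop

lemma norm_trigSum_le (c : ℤ →₀ ℝ) (θ : ℝ) : ‖trigSum c θ‖ ≤ c.sum fun _ a => |a| := by
  refine (norm_sum_le _ _).trans (Finset.sum_le_sum fun n _ => ?_)
  rw [norm_mul, Complex.norm_exp_ofReal_mul_I, mul_one, Complex.norm_real, Real.norm_eq_abs]

/-- The process `X n` is the image, under an isonormal embedding, of the function `θ ↦ e^{inθ}` in
`L²(μ)`, seen as a real Hilbert space. -/
theorem exists_isGaussianLaw (μ : Measure ℝ) [IsProbabilityMeasure μ] :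
    ∃ ν : Measure (ℤ → ℝ), IsProbabilityMeasure ν ∧ IsGaussianLaw μ ν := by
  obtain ⟨ι, W, hW⟩ := exists_isonormal (H := Lp ℂ 2 μ)
  have hu : ∀ n : ℤ, MemLp (fun θ : ℝ => exp ((n * θ : ℝ) * I)) 2 μ := fun n =>
    MemLp.of_bound (by fun_prop) 1
      (Eventually.of_forall fun θ => (Complex.norm_exp_ofReal_mul_I _).le)
  let u : ℤ → Lp ℂ 2 μ := fun n => (hu n).toLp
  let Y : (ι → ℝ) → ℤ → ℝ := fun x n => W (u n) x
  have hY : AEMeasurable Y (stdGaussians ι) :=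
    aemeasurable_pi_iff.2 fun n => (Lp.aestronglyMeasurable (W (u n))).aemeasurable
  refine ⟨(stdGaussians ι).map Y, Measure.isProbabilityMeasure_map hY, fun c => ?_⟩
  have hnorm : ‖∑ n ∈ c.support, c n • u n‖ ^ 2 = energy μ c := by
    rw [← real_inner_self_eq_norm_sq, L2.inner_def, energy]
    refine integral_congr_ae ?_
    filter_upwards [coeFn_sum_smul c.support c u, ae_all_iff.2 fun n => (hu n).coeFn_toLp]
      with θ h1 h2
    rw [h1, real_inner_self_eq_norm_sq, trigSum, Finsupp.sum]
    simp only [u, h2, Complex.real_smul]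
  have hcont : Continuous fun x : ℤ → ℝ => exp (pairing c x * I) := by
    have := continuous_pairing c
    fun_prop
  rw [integral_map hY hcont.aestronglyMeasurable, ← hnorm, ← hW]
  refine integral_congr_ae ?_
  filter_upwards [coeFn_sum_smul c.support c fun n => W (u n)] with x hx
  rw [map_sum]
  simp only [map_smul]
  rw [hx]
  rfl

end Gaussian

/-! ### Sequences whose absolute values have mean zero -/

section Cesaro

/-- The averages of `‖a n‖` over `n < N` tend to `0`. -/
def CesaroNull (a : ℕ → ℂ) : Prop :=
  Tendsto (fun N : ℕ => (N : ℝ)⁻¹ * ∑ n ∈ Finset.range N, ‖a n‖) atTop (𝓝 0)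

lemma average_nonneg (a : ℕ → ℂ) (N : ℕ) : 0 ≤ (N : ℝ)⁻¹ * ∑ n ∈ Finset.range N, ‖a n‖ := by
  positivity

lemma average_le {a : ℕ → ℝ} {C : ℝ} (hC : 0 ≤ C) (h : ∀ n, a n ≤ C) (N : ℕ) :
    (N : ℝ)⁻¹ * ∑ n ∈ Finset.range N, a n ≤ C := by
  rcases Nat.eq_zero_or_pos N with rfl | hN
  · simpa using hC
  · have hN' : (0 : ℝ) < N := by exact_mod_cast hN
    rw [inv_mul_le_iff₀ hN']
    refine (Finset.sum_le_card_nsmul _ _ C fun n _ => h n).trans ?_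
    simp

lemma CesaroNull.of_norm_le {a a' : ℕ → ℂ} {C : ℝ} (h : CesaroNull a)
    (hle : ∀ n, ‖a' n‖ ≤ C * ‖a n‖) : CesaroNull a' := by
  have h1 := Tendsto.const_mul C h
  rw [mul_zero] at h1
  refine squeeze_zero (average_nonneg a') (fun N => ?_) h1
  have : ∑ n ∈ Finset.range N, ‖a' n‖ ≤ C * ∑ n ∈ Finset.range N, ‖a n‖ := by
    rw [Finset.mul_sum]
    exact Finset.sum_le_sum fun n _ => hle n
  calc (N : ℝ)⁻¹ * ∑ n ∈ Finset.range N, ‖a' n‖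
      ≤ (N : ℝ)⁻¹ * (C * ∑ n ∈ Finset.range N, ‖a n‖) := by gcongr
    _ = _ := by ring

lemma CesaroNull.add {a a' : ℕ → ℂ} (h : CesaroNull a) (h' : CesaroNull a') :
    CesaroNull fun n => a n + a' n := by
  have h1 := Tendsto.add h h'
  rw [add_zero] at h1
  refine squeeze_zero (average_nonneg _) (fun N => ?_) h1
  rw [← mul_add, ← Finset.sum_add_distrib]
  gcongr
  exact norm_add_le _ _

lemma CesaroNull.of_approx {a : ℕ → ℂ}
    (h : ∀ ε > 0, ∃ a', CesaroNull a' ∧ ∀ n, ‖a n - a' n‖ ≤ ε) : CesaroNull a := by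
  rw [CesaroNull, Metric.tendsto_atTop]
  intro ε hε
  obtain ⟨a', ha', hle⟩ := h (ε / 2) (by positivity)
  obtain ⟨N₀, hN₀⟩ := (Metric.tendsto_atTop.1 ha') (ε / 2) (by positivity)
  refine ⟨N₀, fun N hN => ?_⟩
  have h1 := hN₀ N hN
  rw [Real.dist_eq, sub_zero, abs_of_nonneg (average_nonneg _ _)] at h1 ⊢
  have h2 : (N : ℝ)⁻¹ * ∑ n ∈ Finset.range N, ‖a n‖
      ≤ (N : ℝ)⁻¹ * ∑ n ∈ Finset.range N, ‖a' n‖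
        + (N : ℝ)⁻¹ * ∑ n ∈ Finset.range N, ‖a n - a' n‖ := by
    rw [← mul_add, ← Finset.sum_add_distrib]
    gcongr with n _
    calc ‖a n‖ = ‖a' n + (a n - a' n)‖ := by congr 1; ring
      _ ≤ _ := norm_add_le _ _
  have h3 := average_le (by positivity : (0 : ℝ) ≤ ε / 2) hle N
  linarith

/-- For uniformly bounded functionals, mean convergence on a total set implies mean convergence
everywhere. -/
lemma cesaroNull_of_total {H : Type*} [NormedAddCommGroup H] [NormedSpace ℂ H] {L : ℕ → H → ℂ}
    (hadd : ∀ n f g, L n (f + g) = L n f + L n g) (hsmul : ∀ n (z : ℂ) f, L n (z • f) = z * L n f)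
    {C : ℝ} (hbd : ∀ n f, ‖L n f‖ ≤ C * ‖f‖) {s : Set H}
    (hs : (Submodule.span ℂ s).topologicalClosure = ⊤) (h : ∀ f ∈ s, CesaroNull fun n => L n f)
    (f : H) : CesaroNull fun n => L n f := by
  have hspan : ∀ f ∈ Submodule.span ℂ s, CesaroNull fun n => L n f := by
    intro f hf
    induction hf using Submodule.span_induction with
    | mem f hf => exact h f hf
    | zero =>
      have h0 : ∀ n, L n 0 = 0 := fun n => by simpa using hsmul n 0 0
      simp [CesaroNull, h0]
    | add f g _ _ hf hg => simpa only [hadd] using hf.add hg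
    | smul z f _ hf => exact hf.of_norm_le (C := ‖z‖) fun n => by rw [hsmul, norm_mul]
  have hsub : ∀ n f g, L n f - L n g = L n (f - g) := by
    intro n f g
    rw [sub_eq_add_neg f g, hadd, ← neg_one_smul ℂ g, hsmul]
    ring
  refine CesaroNull.of_approx fun ε hε => ?_
  have hmem : f ∈ closure (Submodule.span ℂ s : Set H) := by
    rw [← Submodule.topologicalClosure_coe, hs]
    trivial
  obtain ⟨g, hg, hfg⟩ := Metric.mem_closure_iff.1 hmem (ε / (|C| + 1)) (by positivity)
  refine ⟨_, hspan g hg, fun n => ?_⟩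
  rw [hsub]
  rw [dist_eq_norm, lt_div_iff₀ (by positivity)] at hfg
  calc ‖L n (f - g)‖ ≤ C * ‖f - g‖ := hbd n _
    _ ≤ (|C| + 1) * ‖f - g‖ := by gcongr; linarith [le_abs_self C]
    _ ≤ ε := by linarith

end Cesaro

/-! ### Wiener's lemma -/

section Wiener
open Complex ComplexConjugate

lemma norm_average_exp_le (s : ℝ) (N : ℕ) :
    ‖(N : ℂ)⁻¹ * ∑ n ∈ Finset.range N, exp ((n * s : ℝ) * I)‖ ≤ 1 := by
  rw [norm_mul, norm_inv, Complex.norm_natCast]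
  calc (N : ℝ)⁻¹ * ‖∑ n ∈ Finset.range N, exp ((n * s : ℝ) * I)‖
      ≤ (N : ℝ)⁻¹ * ∑ n ∈ Finset.range N, ‖exp ((n * s : ℝ) * I)‖ := by
        gcongr; exact norm_sum_le _ _
    _ ≤ 1 := average_le zero_le_one (fun n => (Complex.norm_exp_ofReal_mul_I _).le) N

lemma tendsto_average_exp {s : ℝ} (hs : exp (s * I) ≠ 1) :
    Tendsto (fun N : ℕ => (N : ℂ)⁻¹ * ∑ n ∈ Finset.range N, exp ((n * s : ℝ) * I))
      atTop (𝓝 0) := by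
  have hpow : ∀ n : ℕ, exp ((n * s : ℝ) * I) = exp (s * I) ^ n := by
    intro n
    rw [← Complex.exp_nat_mul]
    congr 1
    push_cast
    ring
  have hb : ∀ N : ℕ, ‖(N : ℂ)⁻¹ * ∑ n ∈ Finset.range N, exp ((n * s : ℝ) * I)‖
      ≤ (N : ℝ)⁻¹ * (2 / ‖exp (s * I) - 1‖) := by
    intro N
    rw [norm_mul, norm_inv, Complex.norm_natCast]
    simp only [hpow]
    rw [geom_sum_eq hs, norm_div]
    gcongr
    refine (norm_sub_le _ _).trans ?_
    rw [norm_pow, Complex.norm_exp_ofReal_mul_I, norm_one, one_pow]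
    norm_num
  refine squeeze_zero_norm hb ?_
  simpa using (tendsto_inv_atTop_nhds_zero_nat (𝕜 := ℝ)).mul_const (2 / ‖exp (s * I) - 1‖)

variable {μ : Measure ℝ} [IsProbabilityMeasure μ] [NullSingletonClass μ]

/-- The Fourier coefficients of a density with respect to a non-atomic measure on the circle tend
to zero in mean: the mean of their squares is an integral over the square of the circle of a
bounded kernel that concentrates on the diagonal. -/
theorem cesaroNull_fourier (hμ : ∀ᵐ t ∂μ, t ∈ Set.Ico 0 (2 * Real.pi)) {g : ℝ → ℂ}
    (hg : Measurable g) {C : ℝ} (hC : ∀ t, ‖g t‖ ≤ C) :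
    CesaroNull fun n => ∫ t, g t * exp ((n * t : ℝ) * I) ∂μ := by
  set a : ℕ → ℂ := fun n => ∫ t, g t * exp ((n * t : ℝ) * I) ∂μ with ha
  have hC0 : 0 ≤ C := (norm_nonneg _).trans (hC 0)
  have hint : ∀ (n : ℕ), Integrable (fun t => g t * exp ((n * t : ℝ) * I)) μ := fun n =>
    Integrable.of_bound (C := C) (by fun_prop) (Eventually.of_forall fun t => by
      rw [norm_mul, Complex.norm_exp_ofReal_mul_I, mul_one]; exact hC t)
  have hconj : ∀ n, conj (a n) = ∫ w, conj (g w) * exp ((n * (-w) : ℝ) * I) ∂μ := by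
    intro n
    rw [ha, ← integral_conj]
    refine integral_congr_ae (Eventually.of_forall fun w => ?_)
    simp only [map_mul, ← Complex.exp_conj, Complex.conj_ofReal, Complex.conj_I]
    congr 2
    push_cast
    ring
  have hint' : ∀ (n : ℕ), Integrable (fun w => conj (g w) * exp ((n * (-w) : ℝ) * I)) μ :=
    fun n => Integrable.of_bound (C := C) (by fun_prop) (Eventually.of_forall fun t => by
      rw [norm_mul, Complex.norm_exp_ofReal_mul_I, mul_one, RCLike.norm_conj]; exact hC t)
  -- `G N` is the convolution of the Dirichlet-type averages `K N` with `conj g • μ`; it is bounded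
  -- and tends to `0` pointwise because `μ` has no atoms.
  set K : ℕ → ℝ → ℂ := fun N s => (N : ℂ)⁻¹ * ∑ n ∈ Finset.range N, exp ((n * s : ℝ) * I) with hK
  set G : ℕ → ℝ → ℂ := fun N t => ∫ w, conj (g w) * K N (t - w) ∂μ with hG
  have hGeq : ∀ N t, G N t
      = (N : ℂ)⁻¹ * ∑ n ∈ Finset.range N, exp ((n * t : ℝ) * I) * conj (a n) := by
    intro N t
    simp only [hconj, ← integral_const_mul]
    rw [← integral_finsetSum _ fun n _ => (hint' n).const_mul _, ← integral_const_mul]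
    refine integral_congr_ae (Eventually.of_forall fun w => ?_)
    simp only [hK]
    rw [mul_left_comm, Finset.mul_sum]
    congr 1
    refine Finset.sum_congr rfl fun n _ => ?_
    rw [mul_left_comm, ← Complex.exp_add]
    congr 2
    push_cast
    ring
  have hGbd : ∀ N t, ‖G N t‖ ≤ C := by
    intro N t
    refine (norm_integral_le_of_norm_le_const (C := C) (Eventually.of_forall fun w => ?_)).trans ?_
    · rw [norm_mul, RCLike.norm_conj]
      calc ‖g w‖ * ‖K N (t - w)‖ ≤ C * 1 :=
            mul_le_mul (hC w) (norm_average_exp_le _ _) (norm_nonneg _) hC0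
        _ = C := mul_one C
    · simp
  have hGlim : ∀ t ∈ Set.Ico 0 (2 * Real.pi), Tendsto (fun N => G N t) atTop (𝓝 0) := by
    intro t ht
    have h0 : (0 : ℂ) = ∫ _, (0 : ℂ) ∂μ := by simp
    rw [h0]
    refine tendsto_integral_of_dominated_convergence (fun _ => C) (fun N => ?_)
      (integrable_const C) (fun N => Eventually.of_forall fun w => ?_) ?_
    · have : Measurable fun w => K N (t - w) := by
        simp only [hK]
        fun_prop
      exact (Measurable.mul (by fun_prop) this).aestronglyMeasurable
    · rw [norm_mul, RCLike.norm_conj]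
      calc ‖g w‖ * ‖K N (t - w)‖ ≤ C * 1 :=
            mul_le_mul (hC w) (norm_average_exp_le _ _) (norm_nonneg _) hC0
        _ = C := mul_one C
    · have hne : ∀ᵐ w ∂μ, w ≠ t := by
        rw [ae_iff]
        simp
      filter_upwards [hμ, hne] with w hw hwt
      have : exp (((t - w : ℝ) : ℂ) * I) ≠ 1 := by
        intro h
        rw [Complex.exp_eq_one_iff] at h
        obtain ⟨k, hk⟩ := h
        have hk' : t - w = k * (2 * Real.pi) := by
          have := congrArg Complex.im hk
          simpa using this
        have hpi := Real.pi_pos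
        have h1 : (k : ℝ) < 1 := by nlinarith [ht.1, ht.2, hw.1, hw.2]
        have h2 : (-1 : ℝ) < k := by nlinarith [ht.1, ht.2, hw.1, hw.2]
        have h3 : k < 1 := by exact_mod_cast h1
        have h4 : -1 < k := by exact_mod_cast h2
        have h5 : k = 0 := by omega
        rw [h5] at hk'
        simp only [Int.cast_zero, zero_mul] at hk'
        exact hwt (by linarith)
      simpa only [mul_zero] using (tendsto_average_exp this).const_mul (conj (g w))
  have hsq : Tendsto (fun N : ℕ => (N : ℝ)⁻¹ * ∑ n ∈ Finset.range N, ‖a n‖ ^ 2) atTop (𝓝 0) := by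
    have h1 : Tendsto (fun N : ℕ => ∫ t, g t * G N t ∂μ) atTop (𝓝 0) := by
      have h0 : (0 : ℂ) = ∫ _, (0 : ℂ) ∂μ := by simp
      rw [h0]
      refine tendsto_integral_of_dominated_convergence (fun _ => C * C) (fun N => ?_)
        (integrable_const _) (fun N => Eventually.of_forall fun w => ?_) ?_
      · have : Measurable fun t => G N t := by
          simp only [hGeq]
          fun_prop
        exact (hg.mul this).aestronglyMeasurable
      · rw [norm_mul]
        exact mul_le_mul (hC w) (hGbd N w) (norm_nonneg _) hC0
      · filter_upwards [hμ] with t ht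
        simpa using (hGlim t ht).const_mul (g t)
    have h2 : ∀ N : ℕ, ∫ t, g t * G N t ∂μ
        = (((N : ℝ)⁻¹ * ∑ n ∈ Finset.range N, ‖a n‖ ^ 2 : ℝ) : ℂ) := by
      intro N
      have h3 : ∀ t, g t * G N t = (N : ℂ)⁻¹ *
          ∑ n ∈ Finset.range N, (g t * exp ((n * t : ℝ) * I)) * conj (a n) := by
        intro t
        rw [hGeq, mul_left_comm, Finset.mul_sum]
        congr 1
        exact Finset.sum_congr rfl fun n _ => by ring
      simp only [h3]
      rw [integral_const_mul, integral_finsetSum _ fun n _ => (hint n).mul_const _]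
      simp only [integral_mul_const]
      rw [Complex.ofReal_mul, Complex.ofReal_inv, Complex.ofReal_natCast, Complex.ofReal_sum]
      congr 1
      exact Finset.sum_congr rfl fun n _ => (Complex.mul_conj' (a n)).trans (by push_cast; rfl)
    simp only [h2] at h1
    exact (Complex.continuous_re.tendsto 0).comp h1
  -- The mean of `‖a n‖` is at most the square root of the mean of `‖a n‖ ^ 2`.
  have hsqrt := (Real.continuous_sqrt.tendsto 0).comp hsq
  rw [Real.sqrt_zero] at hsqrt
  refine squeeze_zero (average_nonneg a) (fun N => ?_) hsqrt
  refine Real.le_sqrt_of_sq_le ?_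
  rcases Nat.eq_zero_or_pos N with rfl | hN
  · simp
  · have hN' : (0 : ℝ) < N := by exact_mod_cast hN
    have := sq_sum_le_card_mul_sum_sq (s := Finset.range N) (f := fun n => ‖a n‖)
    rw [Finset.card_range] at this
    rw [mul_pow]
    calc ((N : ℝ)⁻¹) ^ 2 * (∑ n ∈ Finset.range N, ‖a n‖) ^ 2
        ≤ ((N : ℝ)⁻¹) ^ 2 * (N * ∑ n ∈ Finset.range N, ‖a n‖ ^ 2) := by gcongr
      _ = _ := by field_simp

end Wiener

/-! ### Weak mixing and rigidity on a total set of functions -/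

section Koopman

variable {X : Type*} [MeasurableSpace X] {m : Measure X}

lemma koopman_add (T : MPT m) (f g : Lp ℂ 2 m) : koopman T (f + g) = koopman T f + koopman T g :=
  map_add _ _ _

lemma koopman_sub (T : MPT m) (f g : Lp ℂ 2 m) : koopman T (f - g) = koopman T f - koopman T g :=
  map_sub _ _ _

lemma koopman_smul (T : MPT m) (z : ℂ) (f : Lp ℂ 2 m) : koopman T (z • f) = z • koopman T f :=
  map_smul (Lp.compMeasurePreservingₗ ℂ _ T.2.1) z f

lemma norm_koopman (T : MPT m) (f : Lp ℂ 2 m) : ‖koopman T f‖ = ‖f‖ :=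
  Lp.norm_compMeasurePreserving f T.2.1

lemma koopman_mul (S T : MPT m) (f : Lp ℂ 2 m) :
    koopman (S * T) f = koopman T (koopman S f) :=
  Lp.compMeasurePreserving_comp_apply f S.2.1 T.2.1

lemma koopman_one (f : Lp ℂ 2 m) : koopman (1 : MPT m) f = f :=
  Lp.compMeasurePreserving_id_apply f

lemma norm_koopman_inv_sub (T : MPT m) (f : Lp ℂ 2 m) :
    ‖koopman T⁻¹ f - f‖ = ‖koopman T f - f‖ := by
  rw [← norm_koopman T (koopman T⁻¹ f - f), koopman_sub, ← koopman_mul, inv_mul_cancel,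
    koopman_one, norm_sub_rev]

/-- The filter of finite nonempty sets `F` with `min F → ∞`. -/
def ipFilter : Filter (Finset ℕ) := ⨅ K : ℕ, 𝓟 {F | F.Nonempty ∧ ∀ j ∈ F, K ≤ j}

lemma ipFilter_hasBasis :
    ipFilter.HasBasis (fun _ : ℕ => True) fun K => {F | F.Nonempty ∧ ∀ j ∈ F, K ≤ j} := by
  refine hasBasis_iInf_principal (directed_of_isDirected_le fun K L hKL F hF => ?_)
  exact ⟨hF.1, fun j hj => hKL.trans (hF.2 j hj)⟩

lemma ipTendsto_iff {Z : Type*} [TopologicalSpace Z] {q : ℕ → ℕ} {a : ℕ → Z} {L : Z} :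
    IPTendsto q a L ↔ Tendsto (fun F : Finset ℕ => a (∑ j ∈ F, q j)) ipFilter (𝓝 L) := by
  rw [Filter.tendsto_def]
  refine forall₂_congr fun U _ => ?_
  rw [ipFilter_hasBasis.mem_iff]
  simp only [true_and]
  exact exists_congr fun K => ⟨fun h F hF => h F hF.1 hF.2, fun h F h1 h2 => h ⟨h1, h2⟩⟩

/-- Convergence to the identity in the coarse topology is strong convergence of the Koopman
operators to the identity; the condition on the inverses is automatic. -/
lemma tendsto_one_iff {α : Type*} {l : Filter α} {T : α → MPT m} :
    Tendsto T l (𝓝 1) ↔ ∀ f : Lp ℂ 2 m, Tendsto (fun a => ‖koopman (T a) f - f‖) l (𝓝 0) := by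
  constructor
  · intro h f
    rw [Metric.tendsto_nhds]
    intro ε hε
    have hmem : coarseNhd (1 : MPT m) {f} ε ∈ 𝓝 (1 : MPT m) := by
      have hopen : IsOpen (coarseNhd (1 : MPT m) {f} ε) :=
        TopologicalSpace.isOpen_generateFrom_of_mem ⟨1, {f}, ε, hε, rfl⟩
      refine hopen.mem_nhds fun f _ => ?_
      simpa using hε
    filter_upwards [h hmem] with a ha
    have := (ha f (Finset.mem_singleton_self f)).1
    rw [koopman_one] at this
    simpa using this
  · intro h
    refine TopologicalSpace.tendsto_nhds_generateFrom_iff.2 ?_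
    rintro _ ⟨T₀, fs, ε, hε, rfl⟩ h1
    have hall : ∀ᶠ a in l, ∀ f ∈ fs, ‖koopman (T a) f - koopman T₀ f‖ < ε ∧
        ‖koopman (T a)⁻¹ f - koopman T₀⁻¹ f‖ < ε := by
      refine (Finset.eventually_all fs).2 fun f hf => ?_
      obtain ⟨h2, h3⟩ := h1 f hf
      rw [inv_one, koopman_one] at h3
      rw [koopman_one] at h2
      filter_upwards [(h f).eventually (gt_mem_nhds (sub_pos.2 h2)),
        (h f).eventually (gt_mem_nhds (sub_pos.2 h3))] with a h4 h5
      rw [← norm_koopman_inv_sub] at h5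
      constructor
      · have := norm_add_le (koopman (T a) f - f) (f - koopman T₀ f)
        rw [sub_add_sub_cancel] at this
        linarith
      · have := norm_add_le (koopman (T a)⁻¹ f - f) (f - koopman T₀⁻¹ f)
        rw [sub_add_sub_cancel] at this
        linarith
    exact hall

lemma ipRigid_iff {T : MPT m} {b : ℕ → ℕ} :
    IPRigid T b ↔ ∀ f : Lp ℂ 2 m,
      Tendsto (fun F : Finset ℕ => ‖koopman (T ^ ∑ j ∈ F, b j) f - f‖) ipFilter (𝓝 0) := by
  rw [IPRigid, ipTendsto_iff, tendsto_one_iff]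

/-- The functions on which a family of Koopman operators converges to the identity form a closed
subspace. -/
lemma tendsto_koopman_of_total {α : Type*} {l : Filter α} {T : α → MPT m} {s : Set (Lp ℂ 2 m)}
    (hs : (Submodule.span ℂ s).topologicalClosure = ⊤)
    (h : ∀ f ∈ s, Tendsto (fun a => ‖koopman (T a) f - f‖) l (𝓝 0)) (f : Lp ℂ 2 m) :
    Tendsto (fun a => ‖koopman (T a) f - f‖) l (𝓝 0) := by
  have hspan : ∀ f ∈ Submodule.span ℂ s,
      Tendsto (fun a => ‖koopman (T a) f - f‖) l (𝓝 0) := by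
    intro f hf
    induction hf using Submodule.span_induction with
    | mem f hf => exact h f hf
    | zero =>
      have h0 : ∀ a, koopman (T a) 0 = 0 := fun a => map_zero _
      simpa [h0] using tendsto_const_nhds (x := (0 : ℝ)) (f := l)
    | add f g _ _ hf hg =>
      have h1 := hf.add hg
      rw [add_zero] at h1
      refine squeeze_zero (fun _ => norm_nonneg _) (fun a => ?_) h1
      rw [koopman_add, add_sub_add_comm]
      exact norm_add_le _ _
    | smul z f _ hf =>
      have h1 := hf.const_mul ‖z‖
      rw [mul_zero] at h1
      refine h1.congr fun a => ?_
      rw [koopman_smul, ← smul_sub, norm_smul]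
  rw [Metric.tendsto_nhds]
  intro ε hε
  have hmem : f ∈ closure (Submodule.span ℂ s : Set (Lp ℂ 2 m)) := by
    rw [← Submodule.topologicalClosure_coe, hs]
    trivial
  obtain ⟨g, hg, hfg⟩ := Metric.mem_closure_iff.1 hmem (ε / 3) (by positivity)
  rw [dist_eq_norm] at hfg
  filter_upwards [(hspan g hg).eventually (gt_mem_nhds (show 0 < ε / 3 by positivity))] with a ha
  rw [Real.dist_eq, sub_zero, abs_of_nonneg (norm_nonneg _)]
  have h1 : koopman (T a) f - f = koopman (T a) (f - g) + (koopman (T a) g - g) + (g - f) := by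
    rw [koopman_sub]
    abel
  rw [h1]
  have h2 := norm_add₃_le (a := koopman (T a) (f - g)) (b := koopman (T a) g - g) (c := g - f)
  rw [norm_koopman, norm_sub_rev g f] at h2
  linarith

/-- The constant function `1`. -/
noncomputable def oneLp (m : Measure X) [IsFiniteMeasure m] : Lp ℂ 2 m :=
  indicatorConstLp 2 MeasurableSet.univ (measure_ne_top m _) 1

variable [IsProbabilityMeasure m]

/-- The correlation of `g ∘ T ^ n` and `f`, minus its limiting value. -/
noncomputable def correlation (T : MPT m) (g f : Lp ℂ 2 m) (n : ℕ) : ℂ :=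
  inner ℂ (koopman (T ^ n) g) f - inner ℂ g (oneLp m) * inner ℂ (oneLp m) f

lemma norm_correlation_le (T : MPT m) (g f : Lp ℂ 2 m) (n : ℕ) :
    ‖correlation T g f n‖ ≤ (1 + ‖oneLp m‖ ^ 2) * ‖g‖ * ‖f‖ := by
  have h1 := norm_inner_le_norm (𝕜 := ℂ) (koopman (T ^ n) g) f
  have h2 := mul_le_mul (norm_inner_le_norm (𝕜 := ℂ) g (oneLp m))
    (norm_inner_le_norm (𝕜 := ℂ) (oneLp m) f) (norm_nonneg _) (by positivity)
  rw [norm_koopman] at h1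
  refine (norm_sub_le _ _).trans ?_
  rw [norm_mul]
  linarith

lemma correlation_indicator (T : MPT m) {A B : Set X} (hA : MeasurableSet A)
    (hB : MeasurableSet B) (n : ℕ) :
    correlation T (indicatorConstLp 2 hB (measure_ne_top m _) 1)
      (indicatorConstLp 2 hA (measure_ne_top m _) 1) n
      = ((m.real (A ∩ ⇑((T ^ n : MPT m) : Equiv.Perm X) ⁻¹' B) - m.real A * m.real B : ℝ) : ℂ) := by
  have h1 : koopman (T ^ n) (indicatorConstLp 2 hB (measure_ne_top m _) 1)
      = indicatorConstLp 2 ((T ^ n).2.1.measurable hB) (measure_ne_top m _) 1 :=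
    Lp.indicatorConstLp_compMeasurePreserving hB _ _ _
  rw [correlation, h1, oneLp, L2.inner_indicatorConstLp_indicatorConstLp,
    L2.inner_indicatorConstLp_indicatorConstLp, L2.inner_indicatorConstLp_indicatorConstLp,
    Set.inter_univ, Set.univ_inter, Set.inter_comm]
  simp
  ring

/-- Weak mixing may be tested on a total set of functions. -/
theorem weaklyMixing_of_total {T : MPT m} {s : Set (Lp ℂ 2 m)}
    (hs : (Submodule.span ℂ s).topologicalClosure = ⊤)
    (h : ∀ g ∈ s, ∀ f ∈ s, CesaroNull (correlation T g f)) : WeaklyMixing T := by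
  have h1 : ∀ g ∈ s, ∀ f, CesaroNull (correlation T g f) := by
    intro g hg
    refine cesaroNull_of_total (L := fun n f => correlation T g f n)
      (C := (1 + ‖oneLp m‖ ^ 2) * ‖g‖) (fun n f f' => ?_) (fun n z f => ?_)
      (fun n f => norm_correlation_le T g f n) hs (h g hg)
    · simp only [correlation, inner_add_right]
      ring
    · simp only [correlation, inner_smul_right]
      ring
  -- The correlation is conjugate-linear in `g`; its conjugate is linear.
  have h2 : ∀ f g, CesaroNull (correlation T g f) := by
    intro f g
    have := cesaroNull_of_total (L := fun n g => (starRingEnd ℂ) (correlation T g f n))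
      (C := (1 + ‖oneLp m‖ ^ 2) * ‖f‖) (fun n g g' => ?_) (fun n z g => ?_)
      (fun n g => ?_) hs (fun g hg => (h1 g hg f).of_norm_le (C := 1) fun n => by simp) g
    · exact this.of_norm_le (C := 1) fun n => by simp
    · simp only [correlation, koopman_add, inner_add_left, map_sub, map_add, map_mul]
      ring
    · simp only [correlation, koopman_smul, inner_smul_left, map_sub, map_mul, Complex.conj_conj]
      ring
    · rw [RCLike.norm_conj]
      exact (norm_correlation_le T g f n).trans_eq (by ring)
  intro A B hA hB
  have h3 := h2 (indicatorConstLp 2 hA (measure_ne_top m _) 1)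
    (indicatorConstLp 2 hB (measure_ne_top m _) 1)
  simpa only [CesaroNull, correlation_indicator, Complex.norm_real, Real.norm_eq_abs] using h3

end Koopman

/-! ### The shift on a stationary Gaussian process -/

section Shift
open Complex ComplexConjugate ProbabilityTheory

/-- The translate of a coefficient sequence by `k`. -/
noncomputable def translate (k : ℤ) (c : ℤ →₀ ℝ) : ℤ →₀ ℝ := c.mapDomain (· + k)

lemma pairing_translate (k : ℤ) (c : ℤ →₀ ℝ) (x : ℤ → ℝ) :
    pairing (translate k c) x = pairing c fun n => x (n + k) := by
  rw [pairing, translate, Finsupp.sum_mapDomain_index (by simp) (by intros; ring)]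
  rfl

lemma trigSum_translate (k : ℤ) (c : ℤ →₀ ℝ) (θ : ℝ) :
    trigSum (translate k c) θ = exp ((k * θ : ℝ) * I) * trigSum c θ := by
  rw [trigSum, translate, Finsupp.sum_mapDomain_index (by simp) (by intros; push_cast; ring),
    trigSum, Finsupp.mul_sum]
  refine Finsupp.sum_congr fun n _ => ?_
  rw [mul_left_comm, ← Complex.exp_add]
  congr 2
  push_cast
  ring

lemma pairing_sub (c d : ℤ →₀ ℝ) (x : ℤ → ℝ) :
    pairing (c - d) x = pairing c x - pairing d x :=
  Finsupp.sum_sub_index fun _ _ _ => by ring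

lemma trigSum_sub (c d : ℤ →₀ ℝ) (θ : ℝ) : trigSum (c - d) θ = trigSum c θ - trigSum d θ :=
  Finsupp.sum_sub_index fun _ _ _ => by push_cast; ring

lemma energy_translate (μ : Measure ℝ) (k : ℤ) (c : ℤ →₀ ℝ) :
    energy μ (translate k c) = energy μ c := by
  simp only [energy, trigSum_translate, norm_mul, Complex.norm_exp_ofReal_mul_I, one_mul]

/-- A finite measure on `ℤ → ℝ` is determined by its characteristic function on finitely supported
sequences. These carry the discrete topology here, so that the pairing is continuous. -/
lemma ext_of_pairing {P P' : Measure (ℤ → ℝ)} [IsFiniteMeasure P] [IsFiniteMeasure P']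
    (h : ∀ c, ∫ x, exp (pairing c x * I) ∂P = ∫ x, exp (pairing c x * I) ∂P') : P = P' := by
  let _ := TopologicalSpace.upgradeIsCompletelyMetrizable (ℤ → ℝ)
  let _ : TopologicalSpace (ℤ →₀ ℝ) := ⊥
  have : DiscreteTopology (ℤ →₀ ℝ) := ⟨rfl⟩
  let L : (ℤ → ℝ) →ₗ[ℝ] (ℤ →₀ ℝ) →ₗ[ℝ] ℝ :=
    LinearMap.mk₂ ℝ (fun x c => pairing c x)
      (fun x y c => by simp [pairing, Finsupp.sum, mul_add, Finset.sum_add_distrib])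
      (fun a x c => by
        simp only [pairing, Finsupp.sum, Pi.smul_apply, smul_eq_mul, Finset.mul_sum]
        exact Finset.sum_congr rfl fun _ _ => by ring)
      (fun x c d => Finsupp.sum_add_index' (by simp) fun _ _ _ => by ring)
      (fun a x c => by
        simp only [pairing]
        rw [Finsupp.sum_smul_index (by simp), Finsupp.smul_sum]
        exact Finsupp.sum_congr fun _ _ => by rw [smul_eq_mul]; ring)
  have hL' : ∀ x ≠ 0, L x ≠ 0 := by
    intro x hx hL0
    refine hx (funext fun n => ?_)
    have := LinearMap.congr_fun hL0 (Finsupp.single n 1)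
    simpa [L, pairing] using this
  have hL : Continuous fun p : (ℤ → ℝ) × (ℤ →₀ ℝ) => L p.1 p.2 :=
    continuous_prod_of_discrete_right.2 fun c => continuous_pairing c
  refine ext_of_integral_char_eq Real.continuous_probChar
    Real.probChar_ne_one hL' hL fun c => ?_
  exact h c

variable {μ : Measure ℝ} {ν : Measure (ℤ → ℝ)} [IsProbabilityMeasure ν]

/-- The function `x ↦ exp (i ∑ c n x n)`. -/
noncomputable def expFun (c : ℤ →₀ ℝ) (x : ℤ → ℝ) : ℂ := exp (pairing c x * I)

lemma continuous_expFun (c : ℤ →₀ ℝ) : Continuous (expFun c) := by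
  have := continuous_pairing c
  unfold expFun
  fun_prop

lemma norm_expFun (c : ℤ →₀ ℝ) (x : ℤ → ℝ) : ‖expFun c x‖ = 1 :=
  Complex.norm_exp_ofReal_mul_I _

lemma conj_expFun_mul (c d : ℤ →₀ ℝ) (x : ℤ → ℝ) :
    conj (expFun c x) * expFun d x = expFun (d - c) x := by
  simp only [expFun, pairing_sub, ← Complex.exp_conj, ← Complex.exp_add, map_mul,
    Complex.conj_ofReal, Complex.conj_I]
  congr 1
  push_cast
  ring

variable (ν) in
lemma memLp_expFun (c : ℤ →₀ ℝ) : MemLp (expFun c) 2 ν :=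
  MemLp.of_bound (continuous_expFun c).aestronglyMeasurable 1
    (Eventually.of_forall fun x => (norm_expFun c x).le)

variable (ν) in
/-- The function `x ↦ exp (i ∑ c n x n)` as an element of `L²`. -/
noncomputable def expLp (c : ℤ →₀ ℝ) : Lp ℂ 2 ν := (memLp_expFun ν c).toLp

lemma expLp_zero : expLp ν 0 = oneLp ν := by
  rw [expLp, oneLp, indicatorConstLp]
  refine MemLp.toLp_congr _ _ (Eventually.of_forall fun x => ?_)
  simp [expFun, pairing]

lemma inner_expLp (hν : IsGaussianLaw μ ν) (c d : ℤ →₀ ℝ) :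
    inner ℂ (expLp ν c) (expLp ν d) = exp (-(energy μ (d - c) : ℝ) / 2) := by
  rw [← hν, L2.inner_def]
  refine integral_congr_ae ?_
  filter_upwards [(memLp_expFun ν c).coeFn_toLp, (memLp_expFun ν d).coeFn_toLp] with x hc hd
  rw [expLp, expLp, hc, hd, RCLike.inner_apply, mul_comm]
  exact conj_expFun_mul c d x

/-- If all the integrals of a real `g` against exponentials vanish, then the measures with
densities `g⁺` and `g⁻` have the same characteristic function. -/
lemma ae_eq_zero_of_integral_expFun {g : (ℤ → ℝ) → ℝ} (hg : Integrable g ν)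
    (h : ∀ c, ∫ x, (g x : ℂ) * expFun c x ∂ν = 0) : g =ᵐ[ν] 0 := by
  obtain ⟨g', hg'm, hgg'⟩ := hg.1
  have hg'i : Integrable g' ν := hg.congr hgg'
  have hm := hg'm.measurable
  have hfin : ∀ {u : (ℤ → ℝ) → ℝ}, Integrable u ν →
      IsFiniteMeasure (ν.withDensity fun x => ENNReal.ofReal (u x)) := fun hu =>
    isFiniteMeasure_withDensity_ofReal hu.2
  have := hfin hg'i
  have := hfin hg'i.neg
  have hint : ∀ {u : (ℤ → ℝ) → ℝ}, Integrable u ν → ∀ c,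
      Integrable (fun x => (u x : ℂ) * expFun c x) ν := fun hu c =>
    hu.ofReal.mul_bdd (c := 1) (continuous_expFun c).aestronglyMeasurable
      (Eventually.of_forall fun x => (norm_expFun c x).le)
  have hdens : ∀ {u : (ℤ → ℝ) → ℝ}, Measurable u → ∀ c,
      ∫ x, exp (pairing c x * I) ∂(ν.withDensity fun x => ENNReal.ofReal (u x))
        = ∫ x, ((max (u x) 0 : ℝ) : ℂ) * expFun c x ∂ν := by
    intro u hu c
    rw [integral_withDensity_eq_integral_toReal_smul hu.ennreal_ofReal
      (Eventually.of_forall fun x => ENNReal.ofReal_lt_top)]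
    simp only [ENNReal.toReal_ofReal', Complex.real_smul]
    rfl
  have heq : (ν.withDensity fun x => ENNReal.ofReal (g' x))
      = ν.withDensity fun x => ENNReal.ofReal (-g' x) := by
    refine ext_of_pairing fun c => ?_
    have hneg := hdens hm.neg c
    have hnegi := hint hg'i.neg.pos_part c
    simp only [Pi.neg_apply] at hneg hnegi
    rw [hdens hm, hneg, ← sub_eq_zero,
      ← integral_sub (hint hg'i.pos_part c) hnegi, ← h c]
    refine integral_congr_ae ?_
    filter_upwards [hgg'] with x hx
    rw [hx, ← sub_mul, ← Complex.ofReal_sub]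
    congr 2
    rcases le_total 0 (g' x) with h0 | h0
    · simp [h0]
    · simp [h0]
  rw [withDensity_eq_iff_of_sigmaFinite (by fun_prop) (by fun_prop)] at heq
  filter_upwards [heq, hgg'] with x hx hx'
  rw [hx']
  rcases le_total 0 (g' x) with h0 | h0
  · rw [ENNReal.ofReal_of_nonpos (by linarith : -g' x ≤ 0), ENNReal.ofReal_eq_zero] at hx
    exact le_antisymm hx h0
  · rw [ENNReal.ofReal_of_nonpos h0, eq_comm, ENNReal.ofReal_eq_zero] at hx
    exact le_antisymm h0 (neg_nonpos.1 hx)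

variable (ν) in
/-- The exponentials span a dense subspace of `L²`. -/
theorem span_expLp : (Submodule.span ℂ (Set.range (expLp ν))).topologicalClosure = ⊤ := by
  rw [Submodule.topologicalClosure_eq_top_iff, Submodule.eq_bot_iff]
  intro f hf
  have hfi : Integrable f ν := (Lp.memLp f).integrable (by norm_num)
  have h1 : ∀ c, ∫ x, f x * expFun c x ∂ν = 0 := by
    intro c
    have h2 := (Submodule.mem_orthogonal _ _).1 hf (expLp ν (0 - c))
      (Submodule.subset_span ⟨_, rfl⟩)
    rw [L2.inner_def] at h2
    rw [← h2]
    refine integral_congr_ae ?_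
    filter_upwards [(memLp_expFun ν (0 - c)).coeFn_toLp] with x hx
    rw [expLp, hx, RCLike.inner_apply]
    congr 1
    simp only [expFun, pairing_sub, ← Complex.exp_conj, map_mul, Complex.conj_ofReal,
      Complex.conj_I]
    congr 1
    simp [pairing]
  -- Exponentials are stable under conjugation, so `conj f`, and hence `re f` and `im f`, are also
  -- orthogonal to all of them.
  have h2 : ∀ c, ∫ x, conj (f x) * expFun c x ∂ν = 0 := by
    intro c
    have h3 := congrArg conj (h1 (0 - c))
    rw [← integral_conj, map_zero] at h3
    rw [← h3]
    refine integral_congr_ae (Eventually.of_forall fun x => ?_)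
    simp only [expFun, pairing_sub, ← Complex.exp_conj, map_mul, Complex.conj_ofReal,
      Complex.conj_I]
    congr 2
    simp [pairing]
  have hci : Integrable (fun x => conj (f x)) ν := 
    Complex.conjCLE.toContinuousLinearMap.integrable_comp hfi
  have hbd : ∀ {u : (ℤ → ℝ) → ℂ}, Integrable u ν → ∀ c,
      Integrable (fun x => u x * expFun c x) ν := fun hu c =>
    hu.mul_bdd (c := 1) (continuous_expFun c).aestronglyMeasurable
      (Eventually.of_forall fun x => (norm_expFun c x).le)
  have hre := ae_eq_zero_of_integral_expFun hfi.re fun c => by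
    have h3 : ∀ x, ((RCLike.re (f x) : ℝ) : ℂ) * expFun c x
        = (f x * expFun c x + conj (f x) * expFun c x) * (1 / 2) := by
      intro x
      rw [← add_mul, Complex.add_conj]
      simp
      ring
    simp only [h3]
    rw [integral_mul_const, integral_add (hbd hfi c) (hbd hci c), h1, h2]
    simp
  have him := ae_eq_zero_of_integral_expFun hfi.im fun c => by
    have h3 : ∀ x, ((RCLike.im (f x) : ℝ) : ℂ) * expFun c x
        = (f x * expFun c x - conj (f x) * expFun c x) * (1 / (2 * I)) := by
      intro x
      rw [← sub_mul, Complex.sub_conj]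
      simp
      field_simp
      rw [Complex.I_sq]
      ring
    simp only [h3]
    rw [integral_mul_const, integral_sub (hbd hfi c) (hbd hci c), h1, h2]
    simp
  refine (Lp.eq_zero_iff_ae_eq_zero).2 ?_
  filter_upwards [hre, him] with x h3 h4
  exact Complex.ext h3 h4

/-- The shift `(x n) ↦ (x (n + 1))`. -/
def shift : (ℤ → ℝ) ≃ᵐ (ℤ → ℝ) where
  toFun x n := x (n + 1)
  invFun x n := x (n - 1)
  left_inv x := by ext n; simp
  right_inv x := by ext n; simp
  measurable_toFun := measurable_pi_iff.2 fun n => measurable_pi_apply _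
  measurable_invFun := measurable_pi_iff.2 fun n => measurable_pi_apply _

/-- The energy, hence the characteristic function, is invariant under translation. -/
lemma measurePreserving_shift (hν : IsGaussianLaw μ ν) : MeasurePreserving shift ν ν := by
  refine ⟨shift.measurable, ?_⟩
  have := Measure.isProbabilityMeasure_map (μ := ν) shift.measurable.aemeasurable
  refine ext_of_pairing fun c => ?_
  rw [integral_map_equiv, hν, ← energy_translate μ 1, ← hν]
  simp only [pairing_translate]
  rfl

/-- The shift as an invertible measure preserving transformation. -/
def shiftMPT (h : MeasurePreserving shift ν ν) : MPT ν := ⟨shift.toEquiv, h, h.symm shift⟩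

omit [IsProbabilityMeasure ν] in
lemma shiftMPT_pow_apply (h : MeasurePreserving shift ν ν) (k : ℕ) (x : ℤ → ℝ) :
    ((shiftMPT h ^ k : MPT ν) : Equiv.Perm (ℤ → ℝ)) x = fun n => x (n + k) := by
  induction k generalizing x with
  | zero => simp
  | succ k ih =>
    rw [pow_succ]
    change ((shiftMPT h ^ k : MPT ν) : Equiv.Perm (ℤ → ℝ)) (shift x) = _
    rw [ih]
    ext n
    change x (n + k + 1) = x (n + ((k + 1 : ℕ) : ℤ))
    push_cast
    rw [add_assoc]

lemma koopman_shiftMPT_pow (h : MeasurePreserving shift ν ν) (k : ℕ) (c : ℤ →₀ ℝ) :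
    koopman (shiftMPT h ^ k) (expLp ν c) = expLp ν (translate k c) := by
  rw [koopman, expLp, Lp.toLp_compMeasurePreserving, expLp]
  refine MemLp.toLp_congr _ _ (Eventually.of_forall fun x => ?_)
  simp only [Function.comp, shiftMPT_pow_apply, expFun, pairing_translate]

end Shift

/-! ### Mixing and rigidity of the Gaussian shift -/

section GaussianShift
open Complex ComplexConjugate ProbabilityTheory

variable {μ : Measure ℝ} [IsProbabilityMeasure μ] {ν : Measure (ℤ → ℝ)} [IsProbabilityMeasure ν]

omit [IsProbabilityMeasure μ] in
lemma energy_neg (d : ℤ →₀ ℝ) : energy μ (0 - d) = energy μ d := by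
  have h0 : ∀ θ, trigSum 0 θ = 0 := fun θ => Finsupp.sum_zero_index
  refine integral_congr_ae (Eventually.of_forall fun θ => ?_)
  simp only
  rw [trigSum_sub, h0, zero_sub, norm_neg]

lemma integrable_norm_trigSum_sq (c : ℤ →₀ ℝ) : Integrable (fun θ => ‖trigSum c θ‖ ^ 2) μ := by
  refine Integrable.of_bound (C := (c.sum fun _ a => |a|) ^ 2)
    (((continuous_trigSum c).norm.pow 2).aestronglyMeasurable) (Eventually.of_forall fun θ => ?_)
  rw [Real.norm_of_nonneg (by positivity)]
  exact pow_le_pow_left₀ (norm_nonneg _) (norm_trigSum_le c θ) 2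

/-- The variance of a difference, expanded through the covariance
`Re ∫ conj (trigSum c) e^{inθ} trigSum d dμ` of the two summands. -/
lemma energy_sub_translate (c d : ℤ →₀ ℝ) (n : ℕ) :
    energy μ (c - translate n d) = energy μ c + energy μ d -
      2 * (∫ θ, conj (trigSum c θ) * trigSum d θ * exp ((n * θ : ℝ) * I) ∂μ).re := by
  have hbd : ∀ θ, ‖conj (trigSum c θ) * trigSum d θ * exp ((n * θ : ℝ) * I)‖
      ≤ (c.sum fun _ a => |a|) * (d.sum fun _ a => |a|) := by
    intro θ
    rw [norm_mul, Complex.norm_exp_ofReal_mul_I, mul_one, norm_mul, RCLike.norm_conj]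
    exact mul_le_mul (norm_trigSum_le c θ) (norm_trigSum_le d θ) (norm_nonneg _)
      ((norm_nonneg _).trans (norm_trigSum_le c θ))
  have hc := continuous_trigSum c
  have hd := continuous_trigSum d
  have hint : Integrable (fun θ => conj (trigSum c θ) * trigSum d θ * exp ((n * θ : ℝ) * I)) μ :=
    Integrable.of_bound (Continuous.aestronglyMeasurable (by fun_prop)) _
      (Eventually.of_forall hbd)
  have hre : (∫ θ, conj (trigSum c θ) * trigSum d θ * exp ((n * θ : ℝ) * I) ∂μ).re
      = ∫ θ, (conj (trigSum c θ) * trigSum d θ * exp ((n * θ : ℝ) * I)).re ∂μ :=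
    (integral_re hint).symm
  have hint' : Integrable
      (fun θ => (conj (trigSum c θ) * trigSum d θ * exp ((n * θ : ℝ) * I)).re) μ := hint.re
  have hadd : Integrable (fun θ => ‖trigSum c θ‖ ^ 2 + ‖trigSum d θ‖ ^ 2) μ :=
    (integrable_norm_trigSum_sq c).add (integrable_norm_trigSum_sq d)
  rw [hre, energy, energy, energy, ← integral_const_mul,
    ← integral_add (integrable_norm_trigSum_sq c) (integrable_norm_trigSum_sq d),
    ← integral_sub hadd (hint'.const_mul 2)]
  refine integral_congr_ae (Eventually.of_forall fun θ => ?_)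
  have h1 : ‖exp ((n * θ : ℝ) * I) * trigSum d θ‖ = ‖trigSum d θ‖ := by
    rw [norm_mul, Complex.norm_exp_ofReal_mul_I, one_mul]
  have h2 := norm_sub_sq (𝕜 := ℂ) (trigSum c θ) (exp ((n * θ : ℝ) * I) * trigSum d θ)
  rw [h1, RCLike.inner_apply] at h2
  simp only [trigSum_sub, trigSum_translate, Int.cast_natCast, h2]
  have h3 : exp ((n * θ : ℝ) * I) * trigSum d θ * conj (trigSum c θ)
      = conj (trigSum c θ) * trigSum d θ * exp ((n * θ : ℝ) * I) := by ring
  rw [h3]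
  simp only [RCLike.re_eq_complex_re]
  ring

lemma abs_exp_sub_one_le_of_le {x M : ℝ} (hx : |x| ≤ M) :
    |Real.exp x - 1| ≤ Real.exp M * |x| := by
  have hM : 1 ≤ Real.exp M := Real.one_le_exp ((abs_nonneg x).trans hx)
  rcases le_total 0 x with h0 | h0
  · rw [abs_of_nonneg h0] at hx
    rw [abs_of_nonneg h0, abs_of_nonneg (by linarith [Real.add_one_le_exp x])]
    have h1 : 1 - x ≤ Real.exp (-x) := Real.one_sub_le_exp_neg x
    have h2 : Real.exp x * Real.exp (-x) = 1 := by rw [← Real.exp_add]; simp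
    have h3 : Real.exp x - 1 ≤ Real.exp x * x := by nlinarith [Real.exp_pos x]
    have h4 : Real.exp x ≤ Real.exp M := Real.exp_le_exp.2 hx
    nlinarith
  · have h1 : Real.exp x ≤ 1 := Real.exp_le_one_iff.2 h0
    rw [abs_of_nonpos h0, abs_of_nonpos (by linarith)]
    nlinarith [Real.add_one_le_exp x]

/-- The Gaussian shift with non-atomic spectral measure is weakly mixing: the correlations of
exponentials are controlled by Fourier coefficients, to which Wiener's lemma applies. -/
theorem weaklyMixing_shiftMPT [NullSingletonClass μ]
    (hμ : ∀ᵐ t ∂μ, t ∈ Set.Ico 0 (2 * Real.pi)) (hν : IsGaussianLaw μ ν)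
    (h : MeasurePreserving shift ν ν) : WeaklyMixing (shiftMPT h) := by
  refine weaklyMixing_of_total (span_expLp ν) ?_
  rintro _ ⟨d, rfl⟩ _ ⟨c, rfl⟩
  set C : ℝ := (c.sum fun _ a => |a|) * (d.sum fun _ a => |a|) with hCdef
  have hC : ∀ θ, ‖conj (trigSum c θ) * trigSum d θ‖ ≤ C := by
    intro θ
    rw [norm_mul, RCLike.norm_conj]
    exact mul_le_mul (norm_trigSum_le c θ) (norm_trigSum_le d θ) (norm_nonneg _)
      ((norm_nonneg _).trans (norm_trigSum_le c θ))
  have hg : Measurable fun θ => conj (trigSum c θ) * trigSum d θ := by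
    have hc := continuous_trigSum c
    have hd := continuous_trigSum d
    exact Continuous.measurable (by fun_prop)
  refine (cesaroNull_fourier hμ hg hC).of_norm_le (C := Real.exp C) fun n => ?_
  set a := ∫ θ, conj (trigSum c θ) * trigSum d θ * exp ((n * θ : ℝ) * I) ∂μ with ha
  have haC : |a.re| ≤ C := by
    refine (Complex.abs_re_le_norm a).trans ?_
    refine (norm_integral_le_of_norm_le_const (C := C) (Eventually.of_forall fun θ => ?_)).trans ?_
    · rw [norm_mul, Complex.norm_exp_ofReal_mul_I, mul_one]
      exact hC θ
    · simp
  have hcorr : correlation (shiftMPT h) (expLp ν d) (expLp ν c) n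
      = ((Real.exp (-(energy μ c + energy μ d) / 2) * (Real.exp a.re - 1) : ℝ) : ℂ) := by
    rw [correlation, koopman_shiftMPT_pow, ← expLp_zero, inner_expLp hν, inner_expLp hν,
      inner_expLp hν, energy_neg, sub_zero, energy_sub_translate, ← ha, mul_sub, mul_one,
      ← Real.exp_add, ← Complex.exp_add]
    push_cast
    congr 2
    · ring
    · ring
  rw [hcorr, Complex.norm_real, Real.norm_eq_abs, abs_mul, Real.abs_exp]
  have hE : 0 ≤ energy μ c + energy μ d :=
    add_nonneg (integral_nonneg fun _ => by positivity) (integral_nonneg fun _ => by positivity)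
  have h1 : Real.exp (-(energy μ c + energy μ d) / 2) ≤ 1 := Real.exp_le_one_iff.2 (by linarith)
  calc Real.exp (-(energy μ c + energy μ d) / 2) * |Real.exp a.re - 1|
      ≤ 1 * (Real.exp C * |a.re|) :=
        mul_le_mul h1 (abs_exp_sub_one_le_of_le haC) (abs_nonneg _) zero_le_one
    _ ≤ Real.exp C * ‖a‖ := by
        rw [one_mul]
        gcongr
        exact Complex.abs_re_le_norm a

/-- The squared distance is `2 - 2 exp (-E / 2) ≤ E`, where `E` is the variance of
`∑ c n (X n - X (n + N))`, that is, `∫ |trigSum c|² |e^{iNθ} - 1|² dμ`. -/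
lemma norm_koopman_expLp_sub_le (hν : IsGaussianLaw μ ν) (h : MeasurePreserving shift ν ν) {N : ℕ}
    {t : ℝ} (ht : ∀ᵐ θ ∂μ, ‖exp ((N * θ : ℝ) * I) - 1‖ ≤ t) (c : ℤ →₀ ℝ) :
    ‖koopman (shiftMPT h ^ N) (expLp ν c) - expLp ν c‖ ≤ (c.sum fun _ a => |a|) * t := by
  obtain ⟨θ₀, hθ₀⟩ := ht.exists
  have ht0 : 0 ≤ t := (norm_nonneg _).trans hθ₀
  have hC0 : 0 ≤ c.sum fun _ a => |a| := (norm_nonneg _).trans (norm_trigSum_le c 0)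
  refine abs_le_of_sq_le_sq' ?_ (by positivity) |>.2
  have hone : ∀ d, ‖expLp ν d‖ ^ 2 = 1 := by
    intro d
    have h1 : ((‖expLp ν d‖ : ℂ)) ^ 2 = 1 := by
      have := inner_self_eq_norm_sq_to_K (𝕜 := ℂ) (expLp ν d)
      rw [inner_expLp hν, sub_self] at this
      have h0 : energy μ 0 = 0 := by simp [energy, trigSum]
      rw [h0] at this
      simpa using this.symm
    exact_mod_cast h1
  have henergy : energy μ (c - translate N c) ≤ ((c.sum fun _ a => |a|) * t) ^ 2 := by
    have h1 : ∀ᵐ θ ∂μ, ‖trigSum (c - translate N c) θ‖ ^ 2 ≤ ((c.sum fun _ a => |a|) * t) ^ 2 := by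
      filter_upwards [ht] with θ hθ
      refine pow_le_pow_left₀ (norm_nonneg _) ?_ 2
      have : trigSum (c - translate N c) θ
          = -(trigSum c θ * (exp ((N * θ : ℝ) * I) - 1)) := by
        rw [trigSum_sub, trigSum_translate, Int.cast_natCast]
        ring
      rw [this, norm_neg, norm_mul]
      exact mul_le_mul (norm_trigSum_le c θ) hθ (norm_nonneg _) hC0
    have h2 := integral_mono_ae (integrable_norm_trigSum_sq (c - translate N c))
      (integrable_const (((c.sum fun _ a => |a|) * t) ^ 2)) h1
    simpa [energy] using h2
  rw [norm_sub_sq (𝕜 := ℂ), norm_koopman, hone, koopman_shiftMPT_pow, inner_expLp hν]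
  have h3 : exp (-(energy μ (c - translate N c) : ℝ) / 2)
      = ((Real.exp (-energy μ (c - translate N c) / 2) : ℝ) : ℂ) := by push_cast; rfl
  rw [h3]
  simp only [RCLike.re_eq_complex_re, Complex.ofReal_re]
  linarith [Real.add_one_le_exp (-energy μ (c - translate N c) / 2)]

lemma norm_exp_sum_sub_one_le (b : ℕ → ℕ) (θ : ℝ) (F : Finset ℕ) :
    ‖exp ((((∑ j ∈ F, b j : ℕ) : ℝ) * θ : ℝ) * I) - 1‖
      ≤ ∑ j ∈ F, ‖exp (((b j : ℝ) * θ : ℝ) * I) - 1‖ := by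
  induction F using Finset.induction_on with
  | empty => simp
  | insert i F hi ih =>
    rw [Finset.sum_insert hi, Finset.sum_insert hi]
    have : exp ((((b i + ∑ j ∈ F, b j : ℕ) : ℝ) * θ : ℝ) * I) - 1
        = (exp (((b i : ℝ) * θ : ℝ) * I) - 1) + exp (((b i : ℝ) * θ : ℝ) * I) *
          (exp ((((∑ j ∈ F, b j : ℕ) : ℝ) * θ : ℝ) * I) - 1) := by
      rw [mul_sub, ← Complex.exp_add, mul_one]
      have e : (((b i + ∑ j ∈ F, b j : ℕ) : ℝ) * θ : ℝ) * I
          = (((b i : ℝ) * θ : ℝ) : ℂ) * I + ((((∑ j ∈ F, b j : ℕ) : ℝ) * θ : ℝ) : ℂ) * I := by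
        push_cast
        ring
      rw [e]
      ring
    rw [this]
    refine (norm_add_le _ _).trans ?_
    rw [norm_mul, Complex.norm_exp_ofReal_mul_I, one_mul]
    gcongr

/-- The Gaussian shift is IP-rigid along `b` as soon as the deviations `‖e^{i b_n θ} - 1‖` are
dominated, almost everywhere for the spectral measure, by a summable sequence. -/
theorem ipRigid_shiftMPT (hν : IsGaussianLaw μ ν) (h : MeasurePreserving shift ν ν) {b : ℕ → ℕ}
    {δ : ℕ → ℝ} (hδ : Summable δ)
    (hb : ∀ᵐ θ ∂μ, ∀ n, ‖exp (((b n : ℝ) * θ : ℝ) * I) - 1‖ ≤ δ n) :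
    IPRigid (shiftMPT h) b := by
  rw [ipRigid_iff]
  refine tendsto_koopman_of_total (span_expLp ν) ?_
  rintro _ ⟨c, rfl⟩
  have htail : Tendsto (fun F : Finset ℕ => ∑ j ∈ F, δ j) ipFilter (𝓝 0) := by
    rw [Metric.tendsto_nhds]
    intro ε hε
    obtain ⟨s, hs⟩ := summable_iff_vanishing_norm.1 hδ ε hε
    refine ipFilter_hasBasis.mem_iff.2 ⟨s.sup id + 1, trivial, fun F hF => ?_⟩
    have hdisj : Disjoint F s := by
      rw [Finset.disjoint_left]
      intro j hjF hjs
      have h1 := hF.2 j hjF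
      have h2 : j ≤ s.sup id := Finset.le_sup (f := id) hjs
      omega
    simpa using hs F hdisj
  have h1 := htail.const_mul (c.sum fun _ a => |a|)
  rw [mul_zero] at h1
  refine squeeze_zero (fun _ => norm_nonneg _) (fun F => ?_) h1
  refine norm_koopman_expLp_sub_le hν h ?_ c
  filter_upwards [hb] with θ hθ
  exact (norm_exp_sum_sub_one_le b θ F).trans (Finset.sum_le_sum fun j _ => hθ j)

/-- The first coordinate is a standard Gaussian variable, so that no point has positive mass. -/
lemma nullSingletonClass_of_isGaussianLaw (hν : IsGaussianLaw μ ν) : NullSingletonClass ν := by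
  have hmap : ν.map (fun x => x 0) = gaussianReal 0 1 := by
    have := Measure.isProbabilityMeasure_map (μ := ν) (measurable_pi_apply (0 : ℤ)).aemeasurable
    refine Measure.ext_of_charFun (funext fun t => ?_)
    rw [charFun_gaussianReal, charFun_apply_real,
      integral_map (measurable_pi_apply (0 : ℤ)).aemeasurable (by fun_prop)]
    have h1 := hν (Finsupp.single 0 t)
    have h2 : energy μ (Finsupp.single 0 t) = t ^ 2 := by
      simp [energy, trigSum]
    rw [h2] at h1
    simp only [pairing, zero_mul, Finsupp.sum_single_index] at h1
    push_cast at h1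
    rw [h1]
    simp [neg_div]
  refine ⟨fun x => ?_⟩
  have h1 : ν ((fun y : ℤ → ℝ => y 0) ⁻¹' {x 0}) = 0 := by
    rw [← Measure.map_apply (measurable_pi_apply (0 : ℤ)) (measurableSet_singleton _), hmap]
    have := nullSingletonClass_gaussianReal (μ := 0) (v := 1) one_ne_zero
    exact measure_singleton _
  exact measure_mono_null (by rintro y rfl; rfl) h1

end GaussianShift

/-! ### The isomorphism theorem for standard non-atomic probability spaces -/

section Isomorphism
open ProbabilityTheory

lemma continuous_cdf (μ : Measure ℝ) [IsProbabilityMeasure μ] [NullSingletonClass μ] :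
    Continuous (cdf μ) := by
  refine continuous_iff_continuousAt.2 fun x => ?_
  rw [(monotone_cdf μ).continuousAt_iff_leftLim_eq_rightLim, (cdf μ).rightLim_eq]
  have h1 := (cdf μ).measure_singleton x
  rw [measure_cdf, measure_singleton, eq_comm, ENNReal.ofReal_eq_zero] at h1
  exact le_antisymm ((monotone_cdf μ).leftLim_le le_rfl) (by linarith)

/-- The distribution function of a non-atomic measure is uniformly distributed. -/
lemma measure_cdf_le (μ : Measure ℝ) [IsProbabilityMeasure μ] [NullSingletonClass μ] (t : ℝ) :
    μ.real {x | cdf μ x ≤ t} = max 0 (min t 1) := by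
  have hval : ∀ u ∈ Set.Ioo (0 : ℝ) 1, ∃ s, cdf μ s = u := fun u hu =>
    mem_range_of_exists_le_of_exists_ge (continuous_cdf μ)
      (((tendsto_cdf_atBot μ).eventually (gt_mem_nhds hu.1)).exists.imp fun _ h => h.le)
      (((tendsto_cdf_atTop μ).eventually (lt_mem_nhds hu.2)).exists.imp fun _ h => h.le)
  rcases le_or_gt 1 t with h1 | h1
  · have : {x | cdf μ x ≤ t} = Set.univ := by
      ext x
      simpa using (cdf_le_one μ x).trans h1
    rw [this, min_eq_right h1]
    simp
  refine le_antisymm (le_of_forall_gt_imp_ge_of_dense fun u hu => ?_) ?_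
  · rw [min_eq_left h1.le, max_lt_iff] at hu
    rcases le_or_gt 1 u with hu1 | hu1
    · exact measureReal_le_one.trans hu1
    obtain ⟨s, hs⟩ := hval u ⟨hu.1, hu1⟩
    rw [← hs, cdf_eq_real]
    refine measureReal_mono fun x hx => ?_
    by_contra hxs
    have := monotone_cdf μ (not_le.1 hxs).le
    simp only [Set.mem_ofPred_eq] at hx
    linarith
  · rw [min_eq_left h1.le]
    refine max_le measureReal_nonneg ?_
    rcases le_or_gt t 0 with h0 | h0
    · exact h0.trans measureReal_nonneg
    obtain ⟨s, hs⟩ := hval t ⟨h0, h1⟩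
    conv_lhs => rw [← hs, cdf_eq_real]
    exact measureReal_mono fun x hx => (monotone_cdf μ hx).trans hs.le

lemma map_cdf_eq (μ μ' : Measure ℝ) [IsProbabilityMeasure μ] [NullSingletonClass μ]
    [IsProbabilityMeasure μ'] [NullSingletonClass μ'] : μ.map (cdf μ) = μ'.map (cdf μ') := by
  have hm := (monotone_cdf μ).measurable
  have hm' := (monotone_cdf μ').measurable
  have := Measure.isProbabilityMeasure_map (μ := μ) hm.aemeasurable
  have := Measure.isProbabilityMeasure_map (μ := μ') hm'.aemeasurable
  refine Measure.ext_of_Iic _ _ fun t => ?_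
  rw [Measure.map_apply hm measurableSet_Iic, Measure.map_apply hm' measurableSet_Iic]
  have h1 : μ.real (cdf μ ⁻¹' Set.Iic t) = μ'.real (cdf μ' ⁻¹' Set.Iic t) :=
    (measure_cdf_le μ t).trans (measure_cdf_le μ' t).symm
  exact (ENNReal.toReal_eq_toReal_iff' (measure_ne_top _ _) (measure_ne_top _ _)).1 h1

/-- The values of the distribution function that are taken at a rational point form a countable,
hence negligible, set; off its preimage the distribution function is injective. -/
lemma exists_injOn_cdf (μ : Measure ℝ) [IsProbabilityMeasure μ] [NullSingletonClass μ] :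
    ∃ R : Set ℝ, MeasurableSet R ∧ μ Rᶜ = 0 ∧ Set.InjOn (cdf μ) R := by
  have hm := (monotone_cdf μ).measurable
  have hlevel : ∀ u, μ (cdf μ ⁻¹' {u}) = 0 := by
    intro u
    -- The level set lies in `{x | cdf μ x ≤ u}` and misses `{x | cdf μ x ≤ v}` for `v < u`.
    have hle : ∀ v < u, μ.real (cdf μ ⁻¹' {u}) ≤ max 0 (min u 1) - max 0 (min v 1) := by
      intro v hv
      have hmv : MeasurableSet {x | cdf μ x ≤ v} := hm measurableSet_Iic
      rw [← measure_cdf_le μ u, ← measure_cdf_le μ v, le_sub_iff_add_le,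
        ← measureReal_union ?_ hmv]
      · refine measureReal_mono ?_
        rintro x (hx | hx)
        · exact le_of_eq hx
        · exact (Set.mem_Iic.1 hx).trans hv.le
      · rw [Set.disjoint_left]
        intro x hx hx'
        have h1 : cdf μ x = u := hx
        have h2 : cdf μ x ≤ v := hx'
        linarith
    have hlim : Tendsto (fun v : ℝ => max 0 (min u 1) - max 0 (min v 1)) (𝓝[<] u) (𝓝 0) := by
      have hc : Continuous fun v : ℝ => max 0 (min u 1) - max 0 (min v 1) := by fun_prop
      have := (hc.tendsto u).mono_left (nhdsWithin_le_nhds (s := Set.Iio u))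
      simpa using this
    have h0 : μ.real (cdf μ ⁻¹' {u}) ≤ 0 :=
      ge_of_tendsto hlim (eventually_mem_nhdsWithin.mono fun v hv => hle v hv)
    exact (measureReal_eq_zero_iff).1 (le_antisymm h0 measureReal_nonneg)
  refine ⟨(⋃ q : ℚ, cdf μ ⁻¹' {cdf μ q})ᶜ,
    (MeasurableSet.iUnion fun q => hm (measurableSet_singleton _)).compl, ?_, ?_⟩
  · rw [compl_compl]
    exact measure_iUnion_null fun q => hlevel _
  · have key : ∀ x ∈ (⋃ q : ℚ, cdf μ ⁻¹' {cdf μ q})ᶜ, ∀ y, x < y → cdf μ x ≠ cdf μ y := by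
      intro x hx y hxy heq
      obtain ⟨q, hxq, hqy⟩ := exists_rat_btwn hxy
      refine hx (Set.mem_iUnion.2 ⟨q, ?_⟩)
      exact le_antisymm (monotone_cdf μ hxq.le) ((monotone_cdf μ hqy.le).trans heq.symm.le)
    intro x hx y hy heq
    rcases lt_trichotomy x y with h | h | h
    · exact absurd heq (key x hx y h)
    · exact h
    · exact absurd heq.symm (key y hy x h)

/-- Distribution functions provide, on each standard non-atomic probability space, a real random
variable whose law does not depend on the space and which is injective on a set of measure `1`. -/
lemma exists_uniform {α β : Type*} [MeasurableSpace α] [StandardBorelSpace α] [MeasurableSpace β]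
    [StandardBorelSpace β] (μ : Measure α) (μ' : Measure β) [IsProbabilityMeasure μ]
    [NullSingletonClass μ] [IsProbabilityMeasure μ'] [NullSingletonClass μ'] :
    ∃ (G : α → ℝ) (G' : β → ℝ), Measurable G ∧ Measurable G' ∧ μ.map G = μ'.map G' ∧
      (∃ R, MeasurableSet R ∧ μ Rᶜ = 0 ∧ Set.InjOn G R) ∧
      ∃ R', MeasurableSet R' ∧ μ' R'ᶜ = 0 ∧ Set.InjOn G' R' := by
  obtain ⟨e, he⟩ := exists_measurableEmbedding_real α
  obtain ⟨e', he'⟩ := exists_measurableEmbedding_real β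
  have := Measure.isProbabilityMeasure_map (μ := μ) he.measurable.aemeasurable
  have := Measure.isProbabilityMeasure_map (μ := μ') he'.measurable.aemeasurable
  have : NullSingletonClass (μ.map e) := ⟨fun x => by
    rw [he.map_apply]
    exact (Set.subsingleton_singleton.preimage he.injective).measure_zero _⟩
  have : NullSingletonClass (μ'.map e') := ⟨fun x => by
    rw [he'.map_apply]
    exact (Set.subsingleton_singleton.preimage he'.injective).measure_zero _⟩
  have hm := (monotone_cdf (μ.map e)).measurable
  have hm' := (monotone_cdf (μ'.map e')).measurable
  obtain ⟨R, hR, hR0, hRi⟩ := exists_injOn_cdf (μ.map e)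
  obtain ⟨R', hR', hR0', hRi'⟩ := exists_injOn_cdf (μ'.map e')
  refine ⟨cdf (μ.map e) ∘ e, cdf (μ'.map e') ∘ e', hm.comp he.measurable, hm'.comp he'.measurable,
    ?_, ⟨e ⁻¹' R, he.measurable hR, ?_, ?_⟩, ⟨e' ⁻¹' R', he'.measurable hR', ?_, ?_⟩⟩
  · rw [← Measure.map_map hm he.measurable, ← Measure.map_map hm' he'.measurable]
    exact map_cdf_eq _ _
  · rwa [he.map_apply] at hR0
  · exact fun x hx y hy h => he.injective (hRi hx hy h)
  · rwa [he'.map_apply] at hR0'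
  · exact fun x hx y hy h => he'.injective (hRi' hx hy h)

/-- A standard non-atomic probability space is Borel isomorphic to the plane, and uncountably many
disjoint vertical lines cannot all have positive measure. -/
lemma exists_null_uncountable {α : Type*} [MeasurableSpace α] [StandardBorelSpace α]
    (μ : Measure α) [IsProbabilityMeasure μ] [NullSingletonClass μ] :
    ∃ N : Set α, MeasurableSet N ∧ μ N = 0 ∧ ¬ N.Countable := by
  have hα : ¬ Countable α := by
    intro hc
    have h0 : μ Set.univ = 0 := Set.countable_univ.measure_zero μ
    simp at h0
  have hℝ : ¬ Countable (ℝ × ℝ) := by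
    intro hc
    have : Countable ℝ := (Prod.mk_right_injective (0 : ℝ)).countable
    exact Cardinal.not_countable_real Set.countable_univ
  let e : α ≃ᵐ ℝ × ℝ := PolishSpace.measurableEquivOfNotCountable hα hℝ
  let L : ℝ → Set α := fun r => e ⁻¹' (Prod.fst ⁻¹' {r})
  have hL : ∀ r, MeasurableSet (L r) := fun r =>
    e.measurable (measurable_fst (measurableSet_singleton r))
  have hdisj : Pairwise (Function.onFun Disjoint L) := by
    intro r s hrs
    rw [Function.onFun, Set.disjoint_left]
    intro x hx hx'
    exact hrs (Eq.trans (Eq.symm hx) hx')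
  have hcount := Measure.countable_meas_pos_of_disjoint_iUnion (μ := μ) hL hdisj
  obtain ⟨r, hr⟩ : ∃ r, ¬ 0 < μ (L r) := by
    by_contra! hall
    refine Cardinal.not_countable_real (hcount.mono fun r _ => ?_)
    exact hall r
  refine ⟨L r, hL r, by simpa using hr, fun hc => ?_⟩
  refine Cardinal.not_countable_real ?_
  refine Set.MapsTo.countable_of_injOn (f := fun s => e.symm (r, s)) (t := L r) ?_ ?_ hc
  · intro s _
    simp [L]
  · intro s _ t _ hst
    have := e.symm.injective hst
    exact (Prod.mk.inj this).2

lemma exists_measurableEquiv_of_bijOn {α : Type*} [MeasurableSpace α] [StandardBorelSpace α]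
    {f : α → ℝ} (hf : Measurable f) {s : Set α} (hs : MeasurableSet s) {Z : Set ℝ}
    (h : Set.BijOn f s Z) : ∃ e : s ≃ᵐ Z, ∀ x, (e x : ℝ) = f x := by
  have := hs.standardBorel
  have hm : Measurable (h.equiv f) := (hf.comp measurable_subtype_coe).subtype_mk
  have hme := hm.measurableEmbedding (h.equiv f).injective
  refine ⟨⟨h.equiv f, hm, fun u hu => ?_⟩, fun x => rfl⟩
  have := hme.measurableSet_image' hu
  rwa [Equiv.image_eq_preimage_symm] at this

/-- Two measures concentrated on a set where `G` is injective, with the same image under `G`,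
coincide. -/
lemma eq_of_map_eq_of_injOn {α : Type*} [MeasurableSpace α] [StandardBorelSpace α]
    {μ ρ : Measure α} {G : α → ℝ} (hG : Measurable G) (h : μ.map G = ρ.map G) {R : Set α}
    (hR : MeasurableSet R) (hμ : μ Rᶜ = 0) (hρ : ρ Rᶜ = 0) (hinj : Set.InjOn G R) : μ = ρ := by
  ext B hB
  have key : ∀ {τ : Measure α}, τ Rᶜ = 0 → τ B = τ.map G (G '' (B ∩ R)) := by
    intro τ hτ
    have himg : MeasurableSet (G '' (B ∩ R)) :=
      (hB.inter hR).image_of_measurable_injOn hG (hinj.mono Set.inter_subset_right)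
    rw [Measure.map_apply hG himg]
    refine measure_congr ?_
    have hae : ∀ᵐ x ∂τ, x ∈ R := hτ
    filter_upwards [hae] with x hx
    refine propext ⟨fun hxB => ⟨x, ⟨hxB, hx⟩, rfl⟩, ?_⟩
    rintro ⟨y, ⟨hyB, hyR⟩, hyx⟩
    rwa [← hinj hyR hx hyx]
  rw [key hμ, key hρ, h]

/-- Any two standard non-atomic probability spaces are isomorphic. The null sets left over by the
isomorphism of sets of full measure are matched by a Borel isomorphism, after they have been
enlarged so as to be uncountable. -/
theorem exists_measurePreserving_equiv {α β : Type*} [MeasurableSpace α] [StandardBorelSpace α]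
    [MeasurableSpace β] [StandardBorelSpace β] (μ : Measure α) (μ' : Measure β)
    [IsProbabilityMeasure μ] [NullSingletonClass μ] [IsProbabilityMeasure μ']
    [NullSingletonClass μ'] : ∃ e : α ≃ᵐ β, MeasurePreserving e μ μ' := by
  classical
  obtain ⟨G, G', hG, hG', hmap, ⟨R, hR, hR0, hRi⟩, ⟨R', hR', hR0', hRi'⟩⟩ := exists_uniform μ μ'
  obtain ⟨N, hN, hN0, hNc⟩ := exists_null_uncountable μ
  obtain ⟨N', hN', hN0', hNc'⟩ := exists_null_uncountable μ'
  set Z : Set ℝ := G '' (R \ N) ∩ G' '' (R' \ N') with hZdef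
  have hI : MeasurableSet (G '' (R \ N)) :=
    (hR.diff hN).image_of_measurable_injOn hG (hRi.mono Set.sdiff_subset)
  have hI' : MeasurableSet (G' '' (R' \ N')) :=
    (hR'.diff hN').image_of_measurable_injOn hG' (hRi'.mono Set.sdiff_subset)
  have hZ : MeasurableSet Z := hI.inter hI'
  have hc0 : μ (R \ N)ᶜ = 0 := by
    rw [Set.sdiff_eq, Set.compl_inter, compl_compl]
    exact measure_union_null hR0 hN0
  have hc0' : μ' (R' \ N')ᶜ = 0 := by
    rw [Set.sdiff_eq, Set.compl_inter, compl_compl]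
    exact measure_union_null hR0' hN0'
  have hZ0 : μ.map G Zᶜ = 0 := by
    rw [hZdef, Set.compl_inter]
    refine measure_union_null ?_ ?_
    · rw [Measure.map_apply hG hI.compl]
      exact measure_mono_null (fun x hx hx' => hx ⟨x, hx', rfl⟩) hc0
    · rw [hmap, Measure.map_apply hG' hI'.compl]
      exact measure_mono_null (fun x hx hx' => hx ⟨x, hx', rfl⟩) hc0'
  set A : Set α := (R \ N) ∩ G ⁻¹' Z with hAdef
  set A' : Set β := (R' \ N') ∩ G' ⁻¹' Z with hAdef'
  have hA : MeasurableSet A := (hR.diff hN).inter (hG hZ)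
  have hA' : MeasurableSet A' := (hR'.diff hN').inter (hG' hZ)
  have hA0 : μ Aᶜ = 0 := by
    rw [hAdef, Set.compl_inter]
    refine measure_union_null hc0 ?_
    rw [← Set.preimage_compl, ← Measure.map_apply hG hZ.compl]
    exact hZ0
  have hA0' : μ' A'ᶜ = 0 := by
    rw [hAdef', Set.compl_inter]
    refine measure_union_null hc0' ?_
    rw [← Set.preimage_compl, ← Measure.map_apply hG' hZ.compl, ← hmap]
    exact hZ0
  have hAi : Set.InjOn G A := hRi.mono fun x hx => hx.1.1
  have hAi' : Set.InjOn G' A' := hRi'.mono fun x hx => hx.1.1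
  have hbij : Set.BijOn G A Z := by
    refine ⟨fun x hx => hx.2, hAi, ?_⟩
    rintro z hz
    obtain ⟨x, hx, rfl⟩ := hz.1
    exact ⟨x, ⟨hx, hz⟩, rfl⟩
  have hbij' : Set.BijOn G' A' Z := by
    refine ⟨fun x hx => hx.2, hAi', ?_⟩
    rintro z hz
    obtain ⟨x, hx, rfl⟩ := hz.2
    exact ⟨x, ⟨hx, hz⟩, rfl⟩
  obtain ⟨e₁, he₁⟩ := exists_measurableEquiv_of_bijOn hG hA hbij
  obtain ⟨e₂, he₂⟩ := exists_measurableEquiv_of_bijOn hG' hA' hbij'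
  have hNA : N ⊆ Aᶜ := fun x hx hx' => hx'.1.2 hx
  have hNA' : N' ⊆ A'ᶜ := fun x hx hx' => hx'.1.2 hx
  have hu : ¬ (Aᶜ).Countable := fun hc => hNc (hc.mono hNA)
  have hu' : ¬ (A'ᶜ).Countable := fun hc => hNc' (hc.mono hNA')
  have := hA.compl.standardBorel
  have := hA'.compl.standardBorel
  let e₃ : (Aᶜ : Set α) ≃ᵐ (A'ᶜ : Set β) := PolishSpace.measurableEquivOfNotCountable hu hu'
  let e : α ≃ᵐ β := (MeasurableEquiv.sumCompl hA).symm.trans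
    (((e₁.trans e₂.symm).sumCongr e₃).trans (MeasurableEquiv.sumCompl hA'))
  have heA : ∀ x (hx : x ∈ A), e x = (e₂.symm (e₁ ⟨x, hx⟩) : β) := by
    intro x hx
    have : (MeasurableEquiv.sumCompl hA).symm x = Sum.inl ⟨x, hx⟩ :=
      Equiv.sumCompl_symm_apply_of_pos hx
    change MeasurableEquiv.sumCompl hA' (((e₁.trans e₂.symm).sumCongr e₃)
      ((MeasurableEquiv.sumCompl hA).symm x)) = _
    rw [this]
    rfl
  have hGe : ∀ x ∈ A, G' (e x) = G x := by
    intro x hx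
    rw [heA x hx, ← he₂, MeasurableEquiv.apply_symm_apply, he₁]
  have haeA : ∀ᵐ x ∂μ, x ∈ A := hA0
  refine ⟨e, e.measurable, ?_⟩
  refine eq_of_map_eq_of_injOn hG' ?_ hA' ?_ hA0' hAi'
  · rw [Measure.map_map hG' e.measurable, ← hmap]
    refine Measure.map_congr ?_
    filter_upwards [haeA] with x hx
    exact hGe x hx
  · rw [Measure.map_apply e.measurable hA'.compl]
    have hsub : e ⁻¹' A'ᶜ ⊆ Aᶜ := by
      intro x hx hxA
      refine hx ?_
      rw [heA x hxA]
      exact (e₂.symm (e₁ ⟨x, hxA⟩)).2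
    exact measure_mono_null hsub hA0

end Isomorphism

/-! ### Transport to an arbitrary space -/

section Transport

variable {X Y : Type*} [MeasurableSpace X] [MeasurableSpace Y] {m : Measure X} {ν : Measure Y}

/-- The conjugate of a transformation by an isomorphism. -/
def conjMPT (e : X ≃ᵐ Y) (he : MeasurePreserving e m ν) (T : MPT ν) : MPT m :=
  ⟨(e.toEquiv.trans T.1).trans e.symm.toEquiv,
    (he.symm e).comp (T.2.1.comp he), (he.symm e).comp (T.2.2.comp he)⟩

lemma conjMPT_pow_apply (e : X ≃ᵐ Y) (he : MeasurePreserving e m ν) (T : MPT ν) (n : ℕ) (x : X) :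
    ((conjMPT e he T ^ n : MPT m) : Equiv.Perm X) x
      = e.symm (((T ^ n : MPT ν) : Equiv.Perm Y) (e x)) := by
  induction n generalizing x with
  | zero => exact (e.symm_apply_apply x).symm
  | succ n ih =>
    rw [pow_succ, pow_succ]
    change ((conjMPT e he T ^ n : MPT m) : Equiv.Perm X) (e.symm ((T : Equiv.Perm Y) (e x))) = _
    rw [ih, e.apply_symm_apply]
    rfl

lemma WeaklyMixing.conjMPT {e : X ≃ᵐ Y} {he : MeasurePreserving e m ν} {T : MPT ν}
    (hT : WeaklyMixing T) : WeaklyMixing (conjMPT e he T) := by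
  intro A B hA hB
  have hes := he.symm e
  have hreal : ∀ C : Set X, m.real C = ν.real (e.symm ⁻¹' C) := fun C => by
    rw [Measure.real, Measure.real, hes.measure_preimage_equiv]
  refine (hT _ _ (e.symm.measurable hA) (e.symm.measurable hB)).congr fun N => ?_
  congr 1
  refine Finset.sum_congr rfl fun n _ => ?_
  rw [hreal (A ∩ _), hreal A, hreal B, Set.preimage_inter]
  congr 4
  ext y
  simp only [Set.mem_preimage, conjMPT_pow_apply, e.apply_symm_apply]

lemma IPRigid.conjMPT {e : X ≃ᵐ Y} {he : MeasurePreserving e m ν} {T : MPT ν} {b : ℕ → ℕ}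
    (hT : IPRigid T b) : IPRigid (conjMPT e he T) b := by
  rw [ipRigid_iff] at hT ⊢
  intro f
  have hes := he.symm e
  set g : Lp ℂ 2 ν := Lp.compMeasurePreserving e.symm hes f with hg
  refine (hT g).congr fun F => ?_
  set n := ∑ j ∈ F, b j
  have h1 : koopman (T ^ n) g
      = Lp.compMeasurePreserving e.symm hes (koopman (IPRigidity.conjMPT e he T ^ n) f) := by
    rw [hg, koopman, koopman, ← Lp.compMeasurePreserving_comp_apply,
      ← Lp.compMeasurePreserving_comp_apply]
    congr 2
    ext y
    simp only [Function.comp, conjMPT_pow_apply, e.apply_symm_apply]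
  rw [h1, hg, ← map_sub, Lp.norm_compMeasurePreserving]

end Transport
end IPRigidity

theorem proposition1p3 {X : Type*} [MeasurableSpace X] [StandardBorelSpace X]
    (m : MeasureTheory.Measure X) [MeasureTheory.IsProbabilityMeasure m]
    [MeasureTheory.NullSingletonClass m] (b : ℕ → ℕ) (hb : StrictMono b) (S : Set ℕ) (hS : S.Infinite)
    (hsum : Summable fun n : S => (b n : ℝ) / (b (n + 1) : ℝ))
    (hdvd : ∀ n : ℕ, n ∉ S → b n ∣ b (n + 1)) :
    b ∈ IPRigidity.IPRWM m := by
  obtain ⟨μ, _, _, hμ, δ, hδ, hδb⟩ := IPRigidity.exists_rigid_measure hb hS hsum hdvd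
  obtain ⟨ν, _, hν⟩ := IPRigidity.exists_isGaussianLaw μ
  have := IPRigidity.nullSingletonClass_of_isGaussianLaw hν
  have hshift := IPRigidity.measurePreserving_shift hν
  obtain ⟨e, he⟩ := IPRigidity.exists_measurePreserving_equiv m ν
  exact ⟨hb, IPRigidity.conjMPT e he (IPRigidity.shiftMPT hshift),
    (IPRigidity.weaklyMixing_shiftMPT hμ hν hshift).conjMPT,
    (IPRigidity.ipRigid_shiftMPT hν hshift hδ hδb).conjMPT⟩
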